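/- **$L^1$-convergence of discrete optimal controls.** *Continuous problem.* Let $A\in\mathbb R^{n\times n}$, $B\in\mathbb R^{n\times m}$, $U=[-1,1]^m$, $\mathcal S=\{0\}$, $t_f>0$. For $t\ge 0$ let $\mathcal R(t)$ be the set of all $y_0\in\mathbb R^n$ for which there are a measurable $u:\mathbb R\to U$ and a solution of $\dot y=Ay+Bu$ a.e. on $[0,t]$, $y(0)=y_0$, with $y(t)=0$; let $T(y_0)=\inf\{t\ge 0: y_0\in\mathcal R(t)\}\in[0,\infty]$ be the minimum time function. Put $\bar A=-A$, $\bar B=-B$ (time-reversed system $\dot y=\bar Ay+\bar Bu$, $y(0)=0$). Assume that $\mathcal R(\cdot)$ is strictly expanding, $\mathcal R(s)\subset\operatorname{int}\mathcal R(t)$ for $0\le s<t\le t_f$, and that the normality condition $$\operatorname{rank}\{B\omega,AB\omega,\dots,A^{n-1}B\omega\}=n$$ holds for every nonzero vector $\omega$ along an edge of $U$ (if $m=1$, along the interval $U=[-1,1]$ itself). *Discretization.* Fix $K\ge 1$, $\Delta t=t_f/K$, $t_k=k\Delta t$. For $N\ge1$ let $h=\Delta t/N$, $t_{kj}=t_k+jh$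 ($0\le j\le N$). Consider a sequence of discretizations with $N\to\infty$ (i.e. $h\downarrow0$), each given by matrices $\Phi_h(t_{k'j'},t_{kj})$ for grid points $t_{kj}\le t_{k'j'}$ with $\Phi_h(t,t)=I$ and the semigroup property $\Phi_h(t,s)\Phi_h(s,r)=\Phi_h(t,r)$; weights $c_{kj}\ge0$; finite sets $S_{\mathcal R}^\Delta\subset\mathbb R^n$, $S_U^\Delta\subset\mathbb R^m$ of unit vectors; a set $\widetilde U_\Delta$ consisting of one supporting point of $U$ for each direction in $S_U^\Delta$; and sets $Y_{h\Delta}(t_k)$, where $Y_{h\Delta}(t_0)$ consists of supporting points of $\mathcal S=\{0\}$, and $Y_{h\Delta}(t_{k+1})$ consists of one (arbitrary) supporting point, for each direction in $S_{\mathcal R}^\Delta$, of the convex hull of $$\widetilde Y_{h\Delta}(t_{k+1})=\Phi_h(t_{k+1},t_k)Y_{h\Delta}(t_k)+h\sum_{j=0}^N c_{kj}\Phi_h(t_{k+1},t_{kj})\bar B\,\widetilde U_\Delta,\qquad k=0,\dots,K-1 .$$ Let $\mathcal R_{h\Delta}(t_k)=\operatorname{co}Y_{h\Delta}(t_k)$.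 Assume that for some constants $C$ and $p>0$ independent of $h$ one has $\|e^{(t_{k+1}-t_{kj})\bar A}-\Phi_h(t_{k+1},t_{kj})\|\le Ch^p$ for all $0\le k<K$, $0\le j\le N$. Fix $i\in\{1,\dots,K\}$ and assume that $\mathcal R_{h\Delta}(t_i)\to\mathcal R(t_i)$ in the Hausdorff distance as $h\downarrow 0$. *Controls.* Let $N_C(x)=\{v:\langle v,y-x\rangle\le0\ \forall y\in C\}$ ($x\in C$) denote the normal cone. Let $\hat y\in\mathcal R(t_i)$, $0\ne\zeta\in N_{\mathcal R(t_i)}(\hat y)$, let the row vector function $\eta$ solve $\dot\eta=-\eta\bar A$, $\eta(t_i)=\zeta$, and put $\hat u(t)=\operatorname{sign}(\eta(t)\bar B)^\top$ (componentwise, $\operatorname{sign}0=0$). Given $\hat y_h\in\mathcal R_{h\Delta}(t_i)$ and $\zeta_h\in N_{\mathcal R_{h\Delta}(t_i)}(\hat y_h)$, let $(\eta_{kj})$, $0\le k<i$, $0\le j\le N$, solve $$\eta_{k(j-1)}=\eta_{kj}\Phi_h(t_{kj},t_{k(j-1)}),\qquad \eta_{kN}=\eta_{(k+1)0},\qquad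 \eta_{(i-1)N}=\zeta_h,$$ and let $\hat u_h(t)=\operatorname{sign}(\eta_{kj}\bar B)^\top$ for $t\in[t_{kj},t_{k(j+1)})$, $0\le k<i$, $0\le j<N$, and $\hat u_h(t_i)=\operatorname{sign}(\eta_{(i-1)(N-1)}\bar B)^\top$. *Conclusion.* 1. $\hat u$ is an optimal control for $\hat y$: it is admissible, the solution of $\dot y=\bar Ay+\bar B\hat u$, $y(0)=0$ satisfies $y(t_i)=\hat y$, and $T(\hat y)=t_i$. 2. There are pairs $(\hat y_h,\zeta_h)$, with $\hat y_h\in\mathcal R_{h\Delta}(t_i)$ and $\zeta_h\in N_{\mathcal R_{h\Delta}(t_i)}(\hat y_h)$ for all sufficiently small $h$, such that $(\hat y_h,\zeta_h)\to(\hat y,\zeta)$ as $h\downarrow0$. 3. For every choice of pairs $(\hat y_h,\zeta_h)$ as in 2, $$\int_0^{t_i}\|\hat u(t)-\hat u_h(t)\|_1\,dt\longrightarrow0\qquad(h\downarrow0),$$ where $\|x\|_1=\sum_\mu|x_\mu|$. -/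

import Mathlib

open Filter Topology Set
open scoped Matrix

namespace MinTime

/-- Euclidean space `ℝⁿ` (states, adjoint row vectors and controls). -/
abbrev Vec (n : ℕ) : Type := EuclideanSpace ℝ (Fin n)

/-- Matrix times column vector. -/
noncomputable def mulV {a b : ℕ} (M : Matrix (Fin a) (Fin b) ℝ) (x : Vec b) : Vec a :=
  WithLp.toLp 2 (M *ᵥ x.ofLp)

/-- Row vector times matrix. -/
noncomputable def rowMul {a b : ℕ} (η : Vec a) (M : Matrix (Fin a) (Fin b) ℝ) : Vec b :=
  WithLp.toLp 2 (η.ofLp ᵥ* M)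

/-- The componentwise signum function. -/
noncomputable def signVec {m : ℕ} (v : Vec m) : Vec m :=
  WithLp.toLp 2 fun μ => Real.sign (v μ)

/-- The `ℓ₁`-norm. -/
noncomputable def norm1 {m : ℕ} (v : Vec m) : ℝ := ∑ μ, |v μ|

/-- The spectral norm of a square matrix. -/
noncomputable def specNorm {n : ℕ} (M : Matrix (Fin n) (Fin n) ℝ) : ℝ :=
  ‖Matrix.toEuclideanCLM (n := Fin n) (𝕜 := ℝ) M‖

/-- The control set `[-1,1]^m`. -/
def cube (m : ℕ) : Set (Vec m) := {u | ∀ μ, u μ ∈ Icc (-1 : ℝ) 1}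

/-! ### The continuous-time problem -/

/-- Admissible controls: measurable functions with values in `U`. -/
def IsAdmissible {m : ℕ} (U : Set (Vec m)) (u : ℝ → Vec m) : Prop :=
  Measurable u ∧ ∀ t, u t ∈ U

/-- `y` is the (Carathéodory) solution on `[0,t]` of `y' = A y + B u` a.e., `y(0) = y₀`,
written as the equivalent integral equation. -/
def IsTrajectory {n m : ℕ} (A : Matrix (Fin n) (Fin n) ℝ) (B : Matrix (Fin n) (Fin m) ℝ)
    (u : ℝ → Vec m) (y₀ : Vec n) (t : ℝ) (y : ℝ → Vec n) : Prop :=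
  ContinuousOn y (Icc 0 t) ∧
    ∀ s ∈ Icc 0 t, y s = y₀ + ∫ r in (0 : ℝ)..s, (mulV A (y r) + mulV B (u r))

/-- The (backward) reachable set `R(t)`: the starting points from which the target `S` can be
reached at time `t` along `y' = A y + B u`. -/
def reach {n m : ℕ} (A : Matrix (Fin n) (Fin n) ℝ) (B : Matrix (Fin n) (Fin m) ℝ)
    (U : Set (Vec m)) (S : Set (Vec n)) (t : ℝ) : Set (Vec n) :=
  {y₀ | ∃ u, IsAdmissible U u ∧ ∃ y, IsTrajectory A B u y₀ t y ∧ y t ∈ S}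

/-- The minimum time function `T(y₀) ∈ [0,∞]`: the infimum of all times at which some admissible
trajectory starting in `y₀` is in the target. -/
noncomputable def minTime {n m : ℕ} (A : Matrix (Fin n) (Fin n) ℝ) (B : Matrix (Fin n) (Fin m) ℝ)
    (U : Set (Vec m)) (S : Set (Vec n)) (y₀ : Vec n) : ENNReal :=
  sInf {τ | ∃ t : ℝ, 0 ≤ t ∧ y₀ ∈ reach A B U S t ∧ τ = ENNReal.ofReal t}

/-- `R(·)` is strictly expanding on `[0,t_f]`. -/
def StrictlyExpanding {n m : ℕ} (A : Matrix (Fin n) (Fin n) ℝ) (B : Matrix (Fin n) (Fin m) ℝ)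
    (U : Set (Vec m)) (S : Set (Vec n)) (tf : ℝ) : Prop :=
  ∀ t₁ t₂ : ℝ, 0 ≤ t₁ → t₁ < t₂ → t₂ ≤ tf →
    reach A B U S t₁ ⊆ interior (reach A B U S t₂)

/-- `ω` is a nonzero vector along an edge (a nondegenerate segment that is a face) of `U`.
For `U = [-1,1]` the only edge is `U` itself. -/
def IsAlongEdge {m : ℕ} (U : Set (Vec m)) (ω : Vec m) : Prop :=
  ∃ v w : Vec m, v ≠ w ∧ IsExtreme ℝ U (segment ℝ v w) ∧ ∃ c : ℝ, c ≠ 0 ∧ ω = c • (w - v)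

/-- Normality: `rank {B ω, A B ω, …, A^(n-1) B ω} = n` for every nonzero `ω` along an edge. -/
def IsNormal {n m : ℕ} (A : Matrix (Fin n) (Fin n) ℝ) (B : Matrix (Fin n) (Fin m) ℝ)
    (U : Set (Vec m)) : Prop :=
  ∀ ω, IsAlongEdge U ω →
    Module.finrank ℝ
      (Submodule.span ℝ (range fun k : Fin n => mulV (A ^ (k : ℕ) * B) ω)) = n

/-- The normal cone of convex analysis; empty at points outside `C`. -/
def normalCone {n : ℕ} (C : Set (Vec n)) (x : Vec n) : Set (Vec n) :=
  {v | x ∈ C ∧ ∀ y ∈ C, inner ℝ v (y - x) ≤ 0}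

/-- Solutions of the adjoint equation `η' = -η Abar`, `η(t_end) = ζ`. -/
def IsAdjoint {n : ℕ} (Abar : Matrix (Fin n) (Fin n) ℝ) (tend : ℝ) (ζ : Vec n)
    (η : ℝ → Vec n) : Prop :=
  (∀ t, HasDerivAt η (-(rowMul (η t) Abar)) t) ∧ η tend = ζ

/-- The control `û(t) = sign(η(t) Bbar)`. -/
noncomputable def signControl {n m : ℕ} (Bbar : Matrix (Fin n) (Fin m) ℝ) (η : ℝ → Vec n)
    (t : ℝ) : Vec m :=
  signVec (rowMul (η t) Bbar)

/-! ### The fully discrete algorithm -/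

/-- `P` consists of one supporting point of `C` for each direction in `dirs`. -/
def IsSupportSelection {n : ℕ} (dirs : Set (Vec n)) (C P : Set (Vec n)) : Prop :=
  ∃ f : Vec n → Vec n,
    (∀ l ∈ dirs, f l ∈ C ∧ ∀ x ∈ C, inner ℝ l x ≤ inner ℝ l (f l)) ∧ P = f '' dirs

/-- The data of one discretization. The time axis is divided into macro intervals of length `Δt`
and each of them into `N` steps of size `h = Δt / N`; the grid point `t_{kj} = k Δt + j h` has the
global index `k N + j`. -/
structure Discretization (n m : ℕ) where
  /-- number of steps per macro interval -/
  N : ℕ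
  N_pos : 0 < N
  /-- one-step transition matrices: `step q = Φ_h(τ_{q+1}, τ_q)` with `τ_q = q h` -/
  step : ℕ → Matrix (Fin n) (Fin n) ℝ
  /-- quadrature weights: `weight k j` belongs to `t_{kj}` on the `k`-th macro interval -/
  weight : ℕ → ℕ → ℝ
  weight_nonneg : ∀ k j, 0 ≤ weight k j
  /-- finitely many unit directions in the state space -/
  dirR : Finset (Vec n)
  dirR_unit : ∀ l ∈ dirR, ‖l‖ = 1
  /-- finitely many unit directions in the control space -/
  dirU : Finset (Vec m)
  dirU_unit : ∀ l ∈ dirU, ‖l‖ = 1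
  /-- the chosen supporting points of the control set -/
  Utilde : Set (Vec m)
  /-- the chosen supporting points `Y(t_k)` of the discrete reachable sets -/
  Y : ℕ → Set (Vec n)

/-- `Φ_h(τ_a, τ_b)` for `b ≤ a` (the identity for `a ≤ b`). -/
noncomputable def transition {n : ℕ} (step : ℕ → Matrix (Fin n) (Fin n) ℝ) :
    ℕ → ℕ → Matrix (Fin n) (Fin n) ℝ
  | 0, _ => 1
  | a + 1, b => if b ≤ a then step a * transition step a b else 1

/-- The semigroup property of `Φ_h`. -/
theorem transition_mul {n : ℕ} (step : ℕ → Matrix (Fin n) (Fin n) ℝ) {a b c : ℕ}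
    (hcb : c ≤ b) (hba : b ≤ a) :
    transition step a b * transition step b c = transition step a c := by
  induction a with
  | zero =>
    obtain rfl : b = 0 := by omega
    simp [transition]
  | succ a ih =>
    rcases Nat.lt_or_ge a b with hab | hab
    · obtain rfl : b = a + 1 := by omega
      simp [transition]
    · have hca : c ≤ a := hcb.trans hab
      simp only [transition, hab, hca, if_true, Matrix.mul_assoc, ih hab]

namespace Discretization

variable {n m : ℕ}

/-- The step size. -/
noncomputable def h (D : Discretization n m) (Δt : ℝ) : ℝ := Δt / D.N

/-- The grid point `t_{kj}`. -/
noncomputable def grid (D : Discretization n m) (Δt : ℝ) (k j : ℕ) : ℝ := k * Δt + j * D.h Δt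

/-- `Ỹ(t_{k+1}) = Φ_h(t_{k+1},t_k) Y(t_k) + h ∑_{j=0}^N c_{kj} Φ_h(t_{k+1},t_{kj}) Bbar Ũ`
(Minkowski sum). -/
def Ytilde (D : Discretization n m) (Bbar : Matrix (Fin n) (Fin m) ℝ) (Δt : ℝ) (k : ℕ) :
    Set (Vec n) :=
  {z | ∃ y ∈ D.Y k, ∃ u : ℕ → Vec m, (∀ j ≤ D.N, u j ∈ D.Utilde) ∧
    z = mulV (transition D.step ((k + 1) * D.N) (k * D.N)) y +
      D.h Δt • ∑ j ∈ Finset.range (D.N + 1),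
        D.weight k j • mulV (transition D.step ((k + 1) * D.N) (k * D.N + j) * Bbar) (u j)}

/-- The sets stored in `D` are produced by `K` steps of the algorithm: supporting points of the
control set `U`, of the target `S`, and of `co Ỹ(t_{k+1})` are selected in the given directions. -/
structure IsRun (D : Discretization n m) (Bbar : Matrix (Fin n) (Fin m) ℝ) (U : Set (Vec m))
    (S : Set (Vec n)) (Δt : ℝ) (K : ℕ) : Prop where
  control : IsSupportSelection (D.dirU : Set (Vec m)) U D.Utilde
  init : IsSupportSelection (D.dirR : Set (Vec n)) S (D.Y 0)
  next : ∀ k < K, IsSupportSelection (D.dirR : Set (Vec n))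
    (convexHull ℝ (D.Ytilde Bbar Δt k)) (D.Y (k + 1))

/-- The fully discrete reachable set `R_{hΔ}(t_k)`. -/
def reachSet (D : Discretization n m) (k : ℕ) : Set (Vec n) := convexHull ℝ (D.Y k)

/-- The ODE solver underlying `Φ_h` has error at most `ε` on each of the `K` macro intervals:
`‖Φ(t_{k+1},t_{kj}) - Φ_h(t_{k+1},t_{kj})‖ ≤ ε`, where `Φ(t,s) = exp((t-s) Abar)`. -/
def SolverError (D : Discretization n m) (Abar : Matrix (Fin n) (Fin n) ℝ) (Δt : ℝ) (K : ℕ)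
    (ε : ℝ) : Prop :=
  ∀ k < K, ∀ j ≤ D.N,
    specNorm (NormedSpace.exp ((D.grid Δt (k + 1) 0 - D.grid Δt k j) • Abar) -
      transition D.step ((k + 1) * D.N) (k * D.N + j)) ≤ ε

/-- Solutions `η_{kj}`, `0 ≤ k < i`, `0 ≤ j ≤ N`, of the discrete adjoint equation
`η_{k(j-1)} = η_{kj} Φ_h(t_{kj}, t_{k(j-1)})`, `η_{(i-1)N} = ζ`, where the indices `kN` and
`(k+1)0` denote the same grid point. -/
structure IsAdjoint (D : Discretization n m) (i : ℕ) (ζ : Vec n) (η : ℕ → ℕ → Vec n) : Prop where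
  back : ∀ k < i, ∀ j < D.N, η k j =
    rowMul (η k (j + 1)) (transition D.step (k * D.N + (j + 1)) (k * D.N + j))
  glue : ∀ k, k + 1 < i → η k D.N = η (k + 1) 0
  final : η (i - 1) D.N = ζ

/-- `u` is, on `[0,t_i]`, the piecewise constant control with the value
`û_{kj} = sign(η_{kj} Bbar)` on `[t_{kj}, t_{k(j+1)})` and `û_{(i-1)(N-1)}` at the end point. -/
structure IsSignControl (D : Discretization n m) (Bbar : Matrix (Fin n) (Fin m) ℝ) (Δt : ℝ)
    (i : ℕ) (η : ℕ → ℕ → Vec n) (u : ℝ → Vec m) : Prop where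
  piece : ∀ k < i, ∀ j < D.N, ∀ t ∈ Ico (D.grid Δt k j) (D.grid Δt k (j + 1)),
    u t = signVec (rowMul (η k j) Bbar)
  final : u (D.grid Δt (i - 1) D.N) = signVec (rowMul (η (i - 1) (D.N - 1)) Bbar)

end Discretization

end MinTime

open MinTime

/-!
A control steering `0` to a point `ŷ` with normal `ζ` must maximize `⟪η(t) B̄, ·⟫` over the cube for
almost every `t`, as one sees by comparing it with `sign(η B̄)`. By normality no component of the
analytic function `η B̄` vanishes identically, so its zeros form a null set and the maximizer
`sign(η B̄)` is unique a.e. Strict expansion puts `R(s)`, `s < t_i`, in the interior of `R(t_i)`,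
where there are no nonzero normals; hence `T(ŷ) = t_i`.

A convergent pair is given by the projection `ŷ_h` of `ŷ + ζ` onto `R_h` and the residual
`ζ_h = ŷ + ζ - ŷ_h`. If `ζ_h → ζ`, then going backwards through the macro intervals the solver error
bound gives `η_h → η` uniformly on the grid. Where no component of `η B̄` vanishes, the signs of
`η_h B̄` and `η B̄` therefore agree for small `h`, and dominated convergence applies.
-/

namespace MinTime

open MeasureTheory

section LinearODE

variable {E : Type*} [NormedAddCommGroup E] [NormedSpace ℝ E] [CompleteSpace E]

theorem exp_sub_smul_apply_eq_of_hasDerivAt_neg {a : E →L[ℝ] E} {η : ℝ → E}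
    (hη : ∀ t, HasDerivAt η (-a (η t)) t) (s t : ℝ) :
    NormedSpace.exp ((s - t) • a) (η s) = η t := by
  have hderiv (r : ℝ) : HasDerivAt (fun r => NormedSpace.exp ((r - t) • a) (η r)) 0 r := by
    have hexp := (hasDerivAt_exp_smul_const (𝕂 := ℝ) a (r - t)).comp_sub_const r t
    simpa using hexp.clm_apply (hη r)
  have hconst := is_const_of_deriv_eq_zero (fun r => (hderiv r).differentiableAt)
    (fun r => (hderiv r).deriv) s t
  simpa using hconst

theorem analyticAt_of_hasDerivAt_neg {a : E →L[ℝ] E} {η : ℝ → E}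
    (hη : ∀ t, HasDerivAt η (-a (η t)) t) (t : ℝ) : AnalyticAt ℝ η t := by
  have hη_eq : η = fun t => NormedSpace.exp ((0 - t) • a) (η 0) :=
    funext fun t => (exp_sub_smul_apply_eq_of_hasDerivAt_neg hη 0 t).symm
  have hlin : AnalyticAt ℝ (fun t : ℝ => (0 - t) • a) t :=
    (analyticAt_const.sub analyticAt_id).smul analyticAt_const
  rw [hη_eq]
  exact ((ContinuousLinearMap.apply ℝ E (η 0)).analyticAt _).comp
    ((NormedSpace.exp_analytic (𝕂 := ℝ) ((0 - t) • a)).comp (f := fun t : ℝ => (0 - t) • a) hlin)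

theorem continuous_exp_smul (a : E →L[ℝ] E) :
    Continuous fun s : ℝ => NormedSpace.exp (s • a) :=
  continuous_iff_continuousAt.2 fun s =>
    (hasDerivAt_exp_smul_const (𝕂 := ℝ) a s).continuousAt

theorem exists_hasDerivAt_eq_apply_add (a : E →L[ℝ] E) {g : ℝ → E} (hg : Continuous g) (x₀ : E) :
    ∃ w : ℝ → E, w 0 = x₀ ∧ ∀ s, HasDerivAt w (a (w s) + g s) s := by
  let c : ℝ → E := fun s => x₀ + ∫ r in (0 : ℝ)..s, NormedSpace.exp (-r • a) (g r)
  have hc (s : ℝ) : HasDerivAt c (NormedSpace.exp (-s • a) (g s)) s := by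
    have hcont : Continuous fun r : ℝ => NormedSpace.exp (-r • a) (g r) :=
      ((continuous_exp_smul a).comp continuous_neg).clm_apply hg
    exact (hcont.integral_hasStrictDerivAt 0 s).hasDerivAt.const_add x₀
  have hinv (s : ℝ) : NormedSpace.exp (s • a) (NormedSpace.exp (-s • a) (g s)) = g s := by
    have hg' (t : ℝ) : HasDerivAt (fun t => NormedSpace.exp (-t • a) (g s))
        (-a (NormedSpace.exp (-t • a) (g s))) t := by
      simpa using ((hasDerivAt_exp_smul_const' (𝕂 := ℝ) a (-t)).scomp t
        (hasDerivAt_neg t)).clm_apply (hasDerivAt_const t (g s))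
    simpa using exp_sub_smul_apply_eq_of_hasDerivAt_neg hg' s 0
  refine ⟨fun s => NormedSpace.exp (s • a) (c s), by simp [c], fun s => ?_⟩
  have hprod := (hasDerivAt_exp_smul_const' (𝕂 := ℝ) a s).clm_apply (hc s)
  rwa [hinv] at hprod

end LinearODE

section Matrix

theorem mulV_mul {a b c : ℕ} (M : Matrix (Fin a) (Fin b) ℝ) (M' : Matrix (Fin b) (Fin c) ℝ)
    (x : Vec c) : mulV (M * M') x = mulV M (mulV M' x) := by
  simp [mulV, Matrix.mulVec_mulVec]

theorem mulV_neg {a b : ℕ} (M : Matrix (Fin a) (Fin b) ℝ) (x : Vec b) :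
    mulV (-M) x = -mulV M x := by
  ext; simp [mulV, Matrix.neg_mulVec]

theorem toEuclideanCLM_eq_mulV {n : ℕ} (M : Matrix (Fin n) (Fin n) ℝ) :
    ⇑(Matrix.toEuclideanCLM (n := Fin n) (𝕜 := ℝ) M) = mulV M := rfl

theorem continuous_mulV {a b : ℕ} (M : Matrix (Fin a) (Fin b) ℝ) : Continuous (mulV M) :=
  (Matrix.toEuclideanLin M).continuous_of_finiteDimensional

theorem rowMul_eq_mulV_transpose {a b : ℕ} (η : Vec a) (M : Matrix (Fin a) (Fin b) ℝ) :
    rowMul η M = mulV Mᵀ η := by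
  simp [rowMul, mulV, Matrix.mulVec_transpose]

theorem continuous_rowMul {a b : ℕ} (M : Matrix (Fin a) (Fin b) ℝ) :
    Continuous fun η : Vec a => rowMul η M := by
  simpa only [rowMul_eq_mulV_transpose] using continuous_mulV Mᵀ

theorem rowMul_mul {a b c : ℕ} (η : Vec a) (M : Matrix (Fin a) (Fin b) ℝ)
    (M' : Matrix (Fin b) (Fin c) ℝ) : rowMul η (M * M') = rowMul (rowMul η M) M' := by
  simp [rowMul, Matrix.vecMul_vecMul]

theorem rowMul_one {a : ℕ} (η : Vec a) : rowMul η (1 : Matrix (Fin a) (Fin a) ℝ) = η := by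
  simp [rowMul]

theorem rowMul_sub {a b : ℕ} (η : Vec a) (M M' : Matrix (Fin a) (Fin b) ℝ) :
    rowMul η (M - M') = rowMul η M - rowMul η M' := by
  ext; simp [rowMul, Matrix.vecMul_sub]

theorem sub_rowMul {a b : ℕ} (η η' : Vec a) (M : Matrix (Fin a) (Fin b) ℝ) :
    rowMul (η - η') M = rowMul η M - rowMul η' M := by
  ext; simp [rowMul, Matrix.sub_vecMul]

theorem inner_rowMul {a b : ℕ} (η : Vec a) (M : Matrix (Fin a) (Fin b) ℝ) (x : Vec b) :
    inner ℝ (rowMul η M) x = inner ℝ η (mulV M x) := by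
  simp only [EuclideanSpace.inner_eq_star_dotProduct, rowMul, mulV, star_trivial]
  rw [dotProduct_comm, dotProduct_comm (M *ᵥ _), Matrix.dotProduct_mulVec]

theorem rowMul_apply {a b : ℕ} (η : Vec a) (M : Matrix (Fin a) (Fin b) ℝ) (μ : Fin b) :
    rowMul η M μ = inner ℝ η (mulV M (EuclideanSpace.single μ 1)) := by
  rw [← inner_rowMul]
  simp [EuclideanSpace.inner_single_right]

variable {n : ℕ}

theorem specNorm_transpose (M : Matrix (Fin n) (Fin n) ℝ) : specNorm Mᵀ = specNorm M := by
  rw [specNorm, specNorm, ← Matrix.conjTranspose_eq_transpose_of_trivial,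
    ← Matrix.star_eq_conjTranspose, map_star, ContinuousLinearMap.star_eq_adjoint,
    LinearIsometryEquiv.norm_map]

theorem norm_rowMul_le (η : Vec n) (M : Matrix (Fin n) (Fin n) ℝ) :
    ‖rowMul η M‖ ≤ specNorm M * ‖η‖ := by
  rw [rowMul_eq_mulV_transpose, ← specNorm_transpose, ← toEuclideanCLM_eq_mulV]
  exact ContinuousLinearMap.le_opNorm _ η

theorem toEuclideanCLM_exp_smul (M : Matrix (Fin n) (Fin n) ℝ) (s : ℝ) :
    Matrix.toEuclideanCLM (n := Fin n) (𝕜 := ℝ) (NormedSpace.exp (s • M)) =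
      NormedSpace.exp (s • Matrix.toEuclideanCLM (n := Fin n) (𝕜 := ℝ) M) := by
  let _ : NormedRing (Matrix (Fin n) (Fin n) ℝ) := Matrix.linftyOpNormedRing
  let _ : NormedAlgebra ℝ (Matrix (Fin n) (Fin n) ℝ) := Matrix.linftyOpNormedAlgebra
  let _ : NormedAlgebra ℚ (Matrix (Fin n) (Fin n) ℝ) := NormedAlgebra.restrictScalars ℚ ℝ _
  have hcont : Continuous (Matrix.toEuclideanCLM (n := Fin n) (𝕜 := ℝ)) :=
    (Matrix.toEuclideanCLM (n := Fin n)
      (𝕜 := ℝ)).toAlgEquiv.toLinearMap.continuous_of_finiteDimensional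
  rw [← map_smul]
  exact NormedSpace.map_exp (Matrix.toEuclideanCLM (n := Fin n) (𝕜 := ℝ)) hcont (s • M)

theorem exists_specNorm_exp_smul_le (M : Matrix (Fin n) (Fin n) ℝ) (a b : ℝ) :
    ∃ C, 0 ≤ C ∧ ∀ s ∈ Icc a b, specNorm (NormedSpace.exp (s • M)) ≤ C := by
  obtain ⟨C, hC⟩ := isCompact_Icc.exists_bound_of_continuousOn
    ((continuous_exp_smul (Matrix.toEuclideanCLM (n := Fin n) (𝕜 := ℝ) M)).continuousOn
      (s := Icc a b))
  refine ⟨max C 0, le_max_right _ _, fun s hs => ?_⟩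
  rw [specNorm, toEuclideanCLM_exp_smul]
  exact (hC s hs).trans (le_max_left _ _)

end Matrix

section Adjoint

variable {n : ℕ} {M : Matrix (Fin n) (Fin n) ℝ} {T : ℝ} {ζ : Vec n} {η : ℝ → Vec n}

theorem IsAdjoint.hasDerivAt_toEuclideanCLM (hη : IsAdjoint M T ζ η) (t : ℝ) :
    HasDerivAt η (-Matrix.toEuclideanCLM (n := Fin n) (𝕜 := ℝ) Mᵀ (η t)) t := by
  simpa only [rowMul_eq_mulV_transpose, toEuclideanCLM_eq_mulV] using hη.1 t

theorem IsAdjoint.continuous (hη : IsAdjoint M T ζ η) : Continuous η :=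
  continuous_iff_continuousAt.2 fun t => (hη.1 t).continuousAt

theorem IsAdjoint.analyticAt (hη : IsAdjoint M T ζ η) (t : ℝ) : AnalyticAt ℝ η t :=
  analyticAt_of_hasDerivAt_neg hη.hasDerivAt_toEuclideanCLM t

theorem IsAdjoint.rowMul_exp (hη : IsAdjoint M T ζ η) (s t : ℝ) :
    rowMul (η s) (NormedSpace.exp ((s - t) • M)) = η t := by
  rw [rowMul_eq_mulV_transpose, ← Matrix.exp_transpose, Matrix.transpose_smul,
    ← toEuclideanCLM_eq_mulV, toEuclideanCLM_exp_smul]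
  exact exp_sub_smul_apply_eq_of_hasDerivAt_neg hη.hasDerivAt_toEuclideanCLM s t

end Adjoint

section Normality

variable {n m : ℕ}

theorem segment_update_eq_cube_inter (μ : Fin m) :
    segment ℝ (WithLp.toLp 2 (Function.update 1 μ (-1)) : Vec m)
      (WithLp.toLp 2 (Function.update 1 μ 1)) =
      {x | x ∈ cube m ∧ ∀ ν ∈ ({μ}ᶜ : Set (Fin m)), x ν = 1} := by
  have himage := image_segment ℝ
    (WithLp.linearEquiv 2 ℝ (Fin m → ℝ)).symm.toLinearMap.toAffineMap
    (Function.update 1 μ (-1)) (Function.update 1 μ 1)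
  rw [← Pi.image_update_segment, segment_eq_Icc (by norm_num)] at himage
  refine himage.symm.trans (Set.ext fun x => ⟨?_, fun ⟨hx, hx1⟩ => ?_⟩)
  · rintro ⟨_, ⟨θ, hθ, rfl⟩, rfl⟩
    refine ⟨fun ν => ?_, fun ν hν => Function.update_of_ne (β := fun _ => ℝ) hν θ 1⟩
    rcases eq_or_ne ν μ with rfl | hν
    · simpa using hθ
    · simp [hν]
  · refine ⟨_, ⟨x μ, hx μ, rfl⟩, ?_⟩
    ext ν
    rcases eq_or_ne ν μ with rfl | hν
    · simp
    · simp [hν, hx1 ν hν]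

theorem isExtreme_cube_inter (s : Set (Fin m)) :
    IsExtreme ℝ (cube m) {x | x ∈ cube m ∧ ∀ ν ∈ s, x ν = 1} := by
  refine ⟨fun x hx => hx.1, ?_⟩
  rintro x hx y hy _ ⟨_, hz⟩ ⟨a, b, ha, hb, hab, rfl⟩
  refine ⟨hx, fun ν hν => ?_⟩
  have hz_one : a * x ν + b * y ν = 1 := by simpa using hz ν hν
  nlinarith [(hx ν).2, (hy ν).2]

theorem isAlongEdge_cube_single (μ : Fin m) :
    IsAlongEdge (cube m) (EuclideanSpace.single μ 1) := by
  have hdiff : (WithLp.toLp 2 (Function.update 1 μ 1) : Vec m) -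
      WithLp.toLp 2 (Function.update (1 : Fin m → ℝ) μ (-1)) =
        (2 : ℝ) • EuclideanSpace.single μ 1 := by
    ext ν
    rcases eq_or_ne ν μ with rfl | hν
    · simpa using one_add_one_eq_two (R := ℝ)
    · simp [hν]
  refine ⟨_, _, fun h => ?_, segment_update_eq_cube_inter μ ▸ isExtreme_cube_inter _,
    1 / 2, by norm_num, by rw [hdiff, smul_smul]; norm_num⟩
  have hμ := congrArg (fun x : Vec m => x μ) h
  norm_num at hμ

variable {A M : Matrix (Fin n) (Fin n) ℝ} {B : Matrix (Fin n) (Fin m) ℝ} {T : ℝ} {ζ : Vec n}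
  {η : ℝ → Vec n}

theorem IsAdjoint.inner_mulV_eq_zero (hη : IsAdjoint M T ζ η) {x : Vec n}
    (hx : ∀ t, inner ℝ (η t) x = 0) (t : ℝ) : inner ℝ (η t) (mulV M x) = 0 := by
  have hderiv := (hη.1 t).inner ℝ (hasDerivAt_const t x)
  rw [funext hx] at hderiv
  simpa [inner_rowMul] using hderiv.unique (hasDerivAt_const t 0)

theorem IsAdjoint.inner_mulV_pow_eq_zero (hη : IsAdjoint (-A) T ζ η) {x : Vec m}
    (hx : ∀ t, inner ℝ (η t) (mulV B x) = 0) (k : ℕ) (t : ℝ) :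
    inner ℝ (η t) (mulV (A ^ k * B) x) = 0 := by
  induction k generalizing t with
  | zero => simpa using hx t
  | succ k ih =>
    rw [pow_succ', Matrix.mul_assoc, mulV_mul]
    simpa [mulV_neg] using hη.inner_mulV_eq_zero ih t

theorem IsNormal.exists_switching_ne_zero (hnormal : IsNormal A B (cube m))
    (hη : IsAdjoint (-A) T ζ η) (hζ : ζ ≠ 0) (μ : Fin m) : ∃ t, rowMul (η t) (-B) μ ≠ 0 := by
  by_contra! hzero
  have horth := hη.inner_mulV_pow_eq_zero (B := B) (x := EuclideanSpace.single μ 1) fun t => by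
    simpa [rowMul_apply, mulV_neg] using hzero t
  have hle : Submodule.span ℝ (range fun k : Fin n =>
      mulV (A ^ (k : ℕ) * B) (EuclideanSpace.single μ 1)) ≤ (ℝ ∙ ζ)ᗮ := by
    rw [Submodule.span_le]
    rintro _ ⟨k, rfl⟩
    rw [SetLike.mem_coe, Submodule.mem_orthogonal_singleton_iff_inner_right, ← hη.2]
    exact horth k T
  have hspan := hnormal _ (isAlongEdge_cube_single μ)
  rw [Submodule.eq_top_of_finrank_eq (hspan.trans finrank_euclideanSpace_fin.symm)] at hle
  exact hζ (inner_self_eq_zero.1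
    (Submodule.mem_orthogonal_singleton_iff_inner_right.1 (hle (Submodule.mem_top (x := ζ)))))

theorem ae_ne_zero_of_analyticOnNhd {f : ℝ → ℝ} (hf : AnalyticOnNhd ℝ f univ)
    (hne : ∃ t, f t ≠ 0) : ∀ᵐ t, f t ≠ 0 := by
  obtain ⟨t, ht⟩ := hne
  have hae := ae_restrict_le_codiscreteWithin (μ := volume) MeasurableSet.univ
    (hf.preimage_zero_mem_codiscrete ht)
  rwa [Measure.restrict_univ] at hae

theorem IsNormal.ae_switching_ne_zero (hnormal : IsNormal A B (cube m))
    (hη : IsAdjoint (-A) T ζ η) (hζ : ζ ≠ 0) : ∀ᵐ t, ∀ μ, rowMul (η t) (-B) μ ≠ 0 := by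
  refine ae_all_iff.2 fun μ => ae_ne_zero_of_analyticOnNhd (fun t _ => ?_)
    (hnormal.exists_switching_ne_zero hη hζ μ)
  simp only [rowMul_apply, real_inner_comm (mulV _ _)]
  exact ((innerSL ℝ _).analyticAt _).comp (hη.analyticAt t)

end Normality

section Sign

variable {m : ℕ}

theorem measurable_sign : Measurable Real.sign :=
  Measurable.ite measurableSet_Iio measurable_const
    (Measurable.ite measurableSet_Ioi measurable_const measurable_const)

theorem sign_mem_Icc (x : ℝ) : Real.sign x ∈ Icc (-1 : ℝ) 1 := by
  rcases Real.sign_apply_eq x with h | h | h <;> rw [h] <;> norm_num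

theorem mul_sign_sub_nonneg {x v : ℝ} (hv : v ∈ Icc (-1 : ℝ) 1) :
    0 ≤ x * (Real.sign x - v) := by
  rcases lt_trichotomy x 0 with hx | rfl | hx
  · rw [Real.sign_of_neg hx]; nlinarith [hv.1]
  · simp
  · rw [Real.sign_of_pos hx]; nlinarith [hv.2]

theorem eventually_sign_eq {x : ℝ} (hx : x ≠ 0) : ∀ᶠ y in 𝓝 x, Real.sign y = Real.sign x := by
  rcases lt_or_gt_of_ne hx with hx | hx
  · filter_upwards [eventually_lt_nhds hx] with y hy
    rw [Real.sign_of_neg hx, Real.sign_of_neg hy]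
  · filter_upwards [eventually_gt_nhds hx] with y hy
    rw [Real.sign_of_pos hx, Real.sign_of_pos hy]

theorem measurable_signVec : Measurable (signVec (m := m)) :=
  (WithLp.measurable_toLp 2 _).comp <| measurable_pi_lambda _ fun μ =>
    measurable_sign.comp (EuclideanSpace.proj (𝕜 := ℝ) μ).continuous.measurable

theorem signVec_mem_cube (v : Vec m) : signVec v ∈ cube m := fun μ => sign_mem_Icc (v μ)

theorem inner_signVec_sub (x v : Vec m) :
    inner ℝ x (signVec x - v) = ∑ μ, x μ * (Real.sign (x μ) - v μ) := by
  simp [PiLp.inner_apply, signVec, mul_comm]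

theorem inner_signVec_sub_nonneg (x : Vec m) {v : Vec m} (hv : v ∈ cube m) :
    0 ≤ inner ℝ x (signVec x - v) := by
  rw [inner_signVec_sub]
  exact Finset.sum_nonneg fun μ _ => mul_sign_sub_nonneg (hv μ)

theorem eq_signVec_of_inner_eq_zero {x v : Vec m} (hv : v ∈ cube m) (hx : ∀ μ, x μ ≠ 0)
    (h : inner ℝ x (signVec x - v) = 0) : v = signVec x := by
  rw [inner_signVec_sub,
    Finset.sum_eq_zero_iff_of_nonneg fun μ _ => mul_sign_sub_nonneg (hv μ)] at h
  ext μ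
  exact (sub_eq_zero.1 ((mul_eq_zero.1 (h μ (Finset.mem_univ μ))).resolve_left (hx μ))).symm

theorem eventually_signVec_eq {x : Vec m} (hx : ∀ μ, x μ ≠ 0) :
    ∀ᶠ y in 𝓝 x, signVec y = signVec x := by
  have hcoord : ∀ᶠ y in 𝓝 x, ∀ μ, Real.sign (y μ) = Real.sign (x μ) := eventually_all.2 fun μ =>
    (EuclideanSpace.proj (𝕜 := ℝ) μ).continuous.continuousAt.eventually (eventually_sign_eq (hx μ))
  filter_upwards [hcoord] with y hy
  ext μ
  exact hy μ

end Sign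

section Admissible

variable {n m : ℕ} {U : Set (Vec m)} {u : ℝ → Vec m}

theorem isBounded_cube (m : ℕ) : Bornology.IsBounded (cube m) := by
  refine ((PiLp.antilipschitzWith_ofLp 2 _).isBounded_preimage
    (Metric.isBounded_Icc (-1 : Fin m → ℝ) 1)).subset fun u hu => ?_
  exact ⟨fun μ => (hu μ).1, fun μ => (hu μ).2⟩

theorem IsAdmissible.intervalIntegrable (hU : Bornology.IsBounded U) (hu : IsAdmissible U u)
    (a b : ℝ) : IntervalIntegrable u volume a b := by
  obtain ⟨C, hC⟩ := hU.exists_norm_le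
  exact (intervalIntegrable_const (c := C)).mono_fun' hu.1.aestronglyMeasurable
    (ae_of_all _ fun t => hC _ (hu.2 t))

theorem IsAdmissible.comp_sub_left (hu : IsAdmissible U u) (T : ℝ) :
    IsAdmissible U fun s => u (T - s) :=
  ⟨hu.1.comp (measurable_const.sub measurable_id), fun _ => hu.2 _⟩

theorem isAdmissible_signControl (B : Matrix (Fin n) (Fin m) ℝ) {η : ℝ → Vec n}
    (hη : Continuous η) : IsAdmissible (cube m) (signControl B η) :=
  ⟨measurable_signVec.comp ((continuous_rowMul B).comp hη).measurable,
    fun _ => signVec_mem_cube _⟩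

end Admissible

section Trajectory

variable {n m : ℕ} {A : Matrix (Fin n) (Fin n) ℝ} {B : Matrix (Fin n) (Fin m) ℝ}
  {U : Set (Vec m)} {S : Set (Vec n)} {u : ℝ → Vec m} {y₀ : Vec n} {T : ℝ} {y : ℝ → Vec n}

theorem intervalIntegrable_mulV (B : Matrix (Fin n) (Fin m) ℝ) {a b : ℝ}
    (hu : IntervalIntegrable u volume a b) :
    IntervalIntegrable (fun r => mulV B (u r)) volume a b :=
  ⟨(Matrix.toEuclideanLin B).toContinuousLinearMap.integrable_comp hu.1,
    (Matrix.toEuclideanLin B).toContinuousLinearMap.integrable_comp hu.2⟩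

theorem IsTrajectory.intervalIntegrable (hu : IntervalIntegrable u volume 0 T)
    (hy : IsTrajectory A B u y₀ T y) (hT : 0 ≤ T) :
    IntervalIntegrable (fun r => mulV A (y r) + mulV B (u r)) volume 0 T :=
  (((continuous_mulV A).comp_continuousOn hy.1).intervalIntegrable_of_Icc hT).add
    (intervalIntegrable_mulV B hu)

theorem IsTrajectory.apply_zero (hy : IsTrajectory A B u y₀ T y) (hT : 0 ≤ T) : y 0 = y₀ := by
  simpa using hy.2 0 ⟨le_rfl, hT⟩

theorem IsTrajectory.congr_ae {v : ℝ → Vec m} (hy : IsTrajectory A B u y₀ T y)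
    (huv : ∀ᵐ r, r ∈ Ioc 0 T → u r = v r) : IsTrajectory A B v y₀ T y := by
  refine ⟨hy.1, fun s hs => ?_⟩
  rw [hy.2 s hs]
  congr 1
  refine intervalIntegral.integral_congr_ae ?_
  filter_upwards [huv] with r hr hrs
  rw [uIoc_of_le hs.1] at hrs
  rw [hr ⟨hrs.1, hrs.2.trans hs.2⟩]

theorem IsTrajectory.reverse (hy : IsTrajectory A B u y₀ T y)
    (hu : IntervalIntegrable u volume 0 T) (hT : 0 ≤ T) :
    IsTrajectory (-A) (-B) (fun s => u (T - s)) (y T) T (fun s => y (T - s)) := by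
  have hmaps : MapsTo (fun s => T - s) (Icc 0 T) (Icc 0 T) := fun s hs =>
    ⟨by linarith [hs.2], by linarith [hs.1]⟩
  refine ⟨hy.1.comp (continuousOn_const.sub continuousOn_id) hmaps, fun s hs => ?_⟩
  have hint := hy.intervalIntegrable hu hT
  have hint_left : IntervalIntegrable (fun r => mulV A (y r) + mulV B (u r)) volume 0 (T - s) :=
    hint.mono_set (by
      rw [uIcc_of_le hT, uIcc_of_le (hmaps hs).1]
      exact Icc_subset_Icc_right (hmaps hs).2)
  have hreflect : ∫ r in (0 : ℝ)..s, (mulV (-A) (y (T - r)) + mulV (-B) (u (T - r))) =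
      -∫ r in (T - s)..T, (mulV A (y r) + mulV B (u r)) := by
    have hsub := intervalIntegral.integral_comp_sub_left (a := 0) (b := s)
      (fun r => mulV A (y r) + mulV B (u r)) T
    rw [sub_zero] at hsub
    rw [← hsub, ← intervalIntegral.integral_neg]
    simp only [mulV_neg, neg_add]
  rw [hreflect, ← intervalIntegral.integral_interval_sub_left hint hint_left,
    hy.2 T ⟨hT, le_rfl⟩]
  simp only [hy.2 (T - s) (hmaps hs)]
  abel

theorem mem_reach_iff (hU : Bornology.IsBounded U) (hT : 0 ≤ T) {x : Vec n} :
    x ∈ reach A B U S T ↔ ∃ u, IsAdmissible U u ∧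
      ∃ y₀ ∈ S, ∃ z, IsTrajectory (-A) (-B) u y₀ T z ∧ z T = x := by
  constructor
  · rintro ⟨u, hu, y, hy, hyT⟩
    refine ⟨_, hu.comp_sub_left T, y T, hyT, _, hy.reverse (hu.intervalIntegrable hU 0 T) hT, ?_⟩
    simp [hy.apply_zero hT]
  · rintro ⟨u, hu, y₀, hy₀, z, hz, rfl⟩
    refine ⟨_, hu.comp_sub_left T, fun s => z (T - s), ?_, ?_⟩
    · simpa using hz.reverse (hu.intervalIntegrable hU 0 T) hT
    · simpa [hz.apply_zero hT] using hy₀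

theorem exists_isTrajectory (A : Matrix (Fin n) (Fin n) ℝ) (B : Matrix (Fin n) (Fin m) ℝ)
    (hu : ∀ a b, IntervalIntegrable u volume a b) (y₀ : Vec n) (T : ℝ) :
    ∃ z, IsTrajectory A B u y₀ T z := by
  have hBu (a b : ℝ) : IntervalIntegrable (fun r => mulV B (u r)) volume a b :=
    intervalIntegrable_mulV B (hu a b)
  set G : ℝ → Vec n := fun s => ∫ r in (0 : ℝ)..s, mulV B (u r)
  have hG : Continuous G := intervalIntegral.continuous_primitive hBu 0
  -- The integral `G` of the inhomogeneity is split off so that the remaining equation is classical.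
  obtain ⟨w, hw0, hw⟩ := exists_hasDerivAt_eq_apply_add
    (Matrix.toEuclideanCLM (n := Fin n) (𝕜 := ℝ) A) ((continuous_mulV A).comp hG) y₀
  have hderiv (s : ℝ) : HasDerivAt w (mulV A (w s + G s)) s := by
    rw [← toEuclideanCLM_eq_mulV, map_add]
    exact hw s
  have hz : Continuous fun s => w s + G s :=
    (continuous_iff_continuousAt.2 fun s => (hderiv s).continuousAt).add hG
  have hAz (s : ℝ) : IntervalIntegrable (fun r => mulV A (w r + G r)) volume 0 s :=
    ((continuous_mulV A).comp hz).intervalIntegrable 0 s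
  refine ⟨fun s => w s + G s, hz.continuousOn, fun s _ => ?_⟩
  rw [intervalIntegral.integral_add (hAz s) (hBu 0 s),
    intervalIntegral.integral_eq_sub_of_hasDerivAt (fun r _ => hderiv r) (hAz s), hw0,
    ← add_assoc, add_sub_cancel]

end Trajectory

section IntegrationByParts

variable {a b : ℝ}

theorem absolutelyContinuousOnInterval_add_primitive {f : ℝ → ℝ}
    (hf : IntervalIntegrable f volume a b) (c : ℝ) :
    AbsolutelyContinuousOnInterval (fun s => c + ∫ r in a..s, f r) a b :=
  (LipschitzWith.const c).lipschitzOnWith.absolutelyContinuousOnInterval.add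
    (hf.absolutelyContinuousOnInterval_intervalIntegral left_mem_uIcc)

theorem ae_deriv_add_primitive {f : ℝ → ℝ} (hf : IntervalIntegrable f volume a b) (c : ℝ) :
    ∀ᵐ s, s ∈ uIoc a b → deriv (fun s => c + ∫ r in a..s, f r) s = f s := by
  filter_upwards [hf.ae_hasDerivAt_integral] with s hs hsab
  exact ((hs (uIoc_subset_uIcc hsab) a left_mem_uIcc).const_add c).deriv

theorem intervalIntegrable_primitive_mul {f g : ℝ → ℝ} (hf : IntervalIntegrable f volume a b)
    (hg : IntervalIntegrable g volume a b) (c d : ℝ) :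
    IntervalIntegrable (fun s => f s * (d + ∫ r in a..s, g r) + (c + ∫ r in a..s, f r) * g s)
      volume a b :=
  (hf.mul_continuousOn (absolutelyContinuousOnInterval_add_primitive hg d).continuousOn).add
    (hg.continuousOn_mul (absolutelyContinuousOnInterval_add_primitive hf c).continuousOn)

theorem integral_primitive_mul {f g : ℝ → ℝ} (hf : IntervalIntegrable f volume a b)
    (hg : IntervalIntegrable g volume a b) (c d : ℝ) :
    ∫ s in a..b, (f s * (d + ∫ r in a..s, g r) + (c + ∫ r in a..s, f r) * g s) =
      (c + ∫ r in a..b, f r) * (d + ∫ r in a..b, g r) - c * d := by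
  have hparts := (absolutelyContinuousOnInterval_add_primitive hf c).integral_deriv_mul_eq_sub
    (absolutelyContinuousOnInterval_add_primitive hg d)
  simp only [intervalIntegral.integral_same, add_zero] at hparts
  rw [← hparts]
  refine intervalIntegral.integral_congr_ae ?_
  filter_upwards [ae_deriv_add_primitive hf c, ae_deriv_add_primitive hg d] with s hfs hgs hs
  rw [hfs hs, hgs hs]

variable {n : ℕ}

theorem intervalIntegrable_apply {f : ℝ → Vec n} (hf : IntervalIntegrable f volume a b)
    (μ : Fin n) : IntervalIntegrable (fun s => f s μ) volume a b :=
  ⟨(EuclideanSpace.proj (𝕜 := ℝ) μ).integrable_comp hf.1,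
    (EuclideanSpace.proj (𝕜 := ℝ) μ).integrable_comp hf.2⟩

theorem add_primitive_apply {f : ℝ → Vec n} (hf : IntervalIntegrable f volume a b) (c : Vec n)
    (μ : Fin n) {s : ℝ} (hs : s ∈ uIcc a b) :
    (c + ∫ r in a..s, f r) μ = c μ + ∫ r in a..s, f r μ :=
  congrArg (c μ + ·) ((EuclideanSpace.proj (𝕜 := ℝ) μ).intervalIntegral_comp_comm
    (hf.mono_set (uIcc_subset_uIcc_left hs))).symm

theorem inner_eq_sum_mul (x y : Vec n) : inner ℝ x y = ∑ μ, x μ * y μ := by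
  simp [PiLp.inner_apply, mul_comm]

theorem integral_inner_primitive {f g : ℝ → Vec n} (hf : IntervalIntegrable f volume a b)
    (hg : IntervalIntegrable g volume a b) (c d : Vec n) :
    ∫ s in a..b, (inner ℝ (f s) (d + ∫ r in a..s, g r) + inner ℝ (c + ∫ r in a..s, f r) (g s)) =
      inner ℝ (c + ∫ r in a..b, f r) (d + ∫ r in a..b, g r) - inner ℝ c d := by
  have hcoord : ∀ s ∈ uIcc a b,
      inner ℝ (f s) (d + ∫ r in a..s, g r) + inner ℝ (c + ∫ r in a..s, f r) (g s) =
        ∑ μ, (f s μ * (d μ + ∫ r in a..s, g r μ) + (c μ + ∫ r in a..s, f r μ) * g s μ) := by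
    intro s hs
    simp only [inner_eq_sum_mul, add_primitive_apply hf c _ hs, add_primitive_apply hg d _ hs,
      Finset.sum_add_distrib]
  rw [intervalIntegral.integral_congr hcoord, intervalIntegral.integral_finsetSum fun μ _ =>
    intervalIntegrable_primitive_mul (intervalIntegrable_apply hf μ)
      (intervalIntegrable_apply hg μ) (c μ) (d μ)]
  simp only [inner_eq_sum_mul, add_primitive_apply hf c _ right_mem_uIcc,
    add_primitive_apply hg d _ right_mem_uIcc, ← Finset.sum_sub_distrib]
  exact Finset.sum_congr rfl fun μ _ => integral_primitive_mul (intervalIntegrable_apply hf μ)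
    (intervalIntegrable_apply hg μ) (c μ) (d μ)

theorem intervalIntegrable_inner {f g : ℝ → Vec n} (hf : ContinuousOn f (uIcc a b))
    (hg : IntervalIntegrable g volume a b) :
    IntervalIntegrable (fun s => inner ℝ (f s) (g s)) volume a b := by
  simp only [inner_eq_sum_mul]
  have hsum := IntervalIntegrable.sum Finset.univ fun μ _ =>
    (intervalIntegrable_apply hg μ).continuousOn_mul
      ((EuclideanSpace.proj (𝕜 := ℝ) μ).continuous.comp_continuousOn hf)
  rw [Finset.sum_fn] at hsum
  exact hsum

end IntegrationByParts

section MaximumPrinciple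

variable {n m : ℕ} {A : Matrix (Fin n) (Fin n) ℝ} {B : Matrix (Fin n) (Fin m) ℝ}
  {U : Set (Vec m)} {S : Set (Vec n)} {T : ℝ} {ζ : Vec n} {η : ℝ → Vec n}

theorem IsAdjoint.eq_add_primitive (hη : IsAdjoint A T ζ η) (t : ℝ) :
    η t = η 0 + ∫ r in (0 : ℝ)..t, -rowMul (η r) A := by
  rw [intervalIntegral.integral_eq_sub_of_hasDerivAt (fun r _ => hη.1 r)
    (((continuous_rowMul A).comp hη.continuous).neg.intervalIntegrable 0 t)]
  abel

theorem IsAdjoint.inner_trajectory (hη : IsAdjoint A T ζ η) (hT : 0 ≤ T) {u : ℝ → Vec m}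
    (hu : IntervalIntegrable u volume 0 T) {y₀ : Vec n} {z : ℝ → Vec n}
    (hz : IsTrajectory A B u y₀ T z) :
    inner ℝ ζ (z T) - inner ℝ (η 0) y₀ =
      ∫ r in (0 : ℝ)..T, inner ℝ (rowMul (η r) B) (u r) := by
  have hη_int : IntervalIntegrable (fun r => -rowMul (η r) A) volume 0 T :=
    ((continuous_rowMul A).comp hη.continuous).neg.intervalIntegrable 0 T
  have hparts := integral_inner_primitive hη_int (hz.intervalIntegrable hu hT) (η 0) y₀
  have hη_prim := hη.eq_add_primitive
  rw [← hη_prim T, ← hz.2 T ⟨hT, le_rfl⟩, hη.2] at hparts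
  rw [← hparts]
  refine intervalIntegral.integral_congr fun r hr => ?_
  rw [uIcc_of_le hT] at hr
  rw [← hη_prim r, ← hz.2 r hr, inner_neg_left, inner_add_right, inner_rowMul, inner_rowMul]
  ring

theorem intervalIntegrable_inner_switching (hη : Continuous η) {u : ℝ → Vec m} {a b : ℝ}
    (hu : IntervalIntegrable u volume a b) :
    IntervalIntegrable (fun r => inner ℝ (rowMul (η r) B) (u r)) volume a b :=
  intervalIntegrable_inner ((continuous_rowMul B).comp hη).continuousOn hu

-- Both controls start in the same point, so the integrals of `⟪η B, ·⟫` compare the end points.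
theorem integral_inner_signControl_sub_nonpos (hη : IsAdjoint (-A) T ζ η) (hT : 0 ≤ T)
    {u : ℝ → Vec m} (hu : IsAdmissible (cube m) u) {y₀ : Vec n} (hy₀ : y₀ ∈ S) {z : ℝ → Vec n}
    (hz : IsTrajectory (-A) (-B) u y₀ T z)
    (hζ : ζ ∈ normalCone (reach A B (cube m) S T) (z T)) :
    ∫ r in (0 : ℝ)..T, inner ℝ (rowMul (η r) (-B)) (signControl (-B) η r - u r) ≤ 0 := by
  have hv : IsAdmissible (cube m) (signControl (-B) η) :=
    isAdmissible_signControl (-B) hη.continuous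
  have hv_int := hv.intervalIntegrable (isBounded_cube m)
  have hu_int := hu.intervalIntegrable (isBounded_cube m)
  obtain ⟨x, hx⟩ := exists_isTrajectory (-A) (-B) hv_int y₀ T
  have hx_reach : x T ∈ reach A B (cube m) S T :=
    (mem_reach_iff (isBounded_cube m) hT).2 ⟨_, hv, y₀, hy₀, x, hx, rfl⟩
  have hle := hζ.2 (x T) hx_reach
  simp only [inner_sub_right] at hle ⊢
  rw [intervalIntegral.integral_sub (intervalIntegrable_inner_switching hη.continuous (hv_int 0 T))
      (intervalIntegrable_inner_switching hη.continuous (hu_int 0 T)),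
    ← hη.inner_trajectory hT (hv_int 0 T) hx, ← hη.inner_trajectory hT (hu_int 0 T) hz]
  linarith

theorem ae_eq_signControl_of_mem_normalCone (hη : IsAdjoint (-A) T ζ η) (hT : 0 ≤ T)
    (hne : ∀ᵐ t, ∀ μ, rowMul (η t) (-B) μ ≠ 0)
    {u : ℝ → Vec m} (hu : IsAdmissible (cube m) u) {y₀ : Vec n} (hy₀ : y₀ ∈ S) {z : ℝ → Vec n}
    (hz : IsTrajectory (-A) (-B) u y₀ T z)
    (hζ : ζ ∈ normalCone (reach A B (cube m) S T) (z T)) :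
    ∀ᵐ t, t ∈ Ioc 0 T → u t = signControl (-B) η t := by
  have hnonneg (t : ℝ) : 0 ≤ inner ℝ (rowMul (η t) (-B)) (signControl (-B) η t - u t) :=
    inner_signVec_sub_nonneg _ (hu.2 t)
  have hv : IsAdmissible (cube m) (signControl (-B) η) :=
    isAdmissible_signControl (-B) hη.continuous
  have hint : IntervalIntegrable
      (fun t => inner ℝ (rowMul (η t) (-B)) (signControl (-B) η t - u t)) volume 0 T :=
    intervalIntegrable_inner_switching hη.continuous
      ((hv.intervalIntegrable (isBounded_cube m) 0 T).sub
        (hu.intervalIntegrable (isBounded_cube m) 0 T))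
  have hzero := le_antisymm (integral_inner_signControl_sub_nonpos hη hT hu hy₀ hz hζ)
    (intervalIntegral.integral_nonneg hT fun t _ => hnonneg t)
  rw [intervalIntegral.integral_eq_zero_iff_of_le_of_nonneg_ae hT (ae_of_all _ hnonneg) hint]
    at hzero
  filter_upwards [(ae_restrict_iff' measurableSet_Ioc).1 hzero, hne] with t ht hne_t htT
  exact eq_signVec_of_inner_eq_zero (hu.2 t) hne_t (ht htT)

theorem exists_isTrajectory_signControl (hη : IsAdjoint (-A) T ζ η) (hT : 0 ≤ T)
    (hne : ∀ᵐ t, ∀ μ, rowMul (η t) (-B) μ ≠ 0) {yhat : Vec n}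
    (hζ : ζ ∈ normalCone (reach A B (cube m) S T) yhat) :
    ∃ y₀ ∈ S, ∃ y, IsTrajectory (-A) (-B) (signControl (-B) η) y₀ T y ∧ y T = yhat := by
  obtain ⟨u, hu, y₀, hy₀, z, hz, rfl⟩ := (mem_reach_iff (isBounded_cube m) hT).1 hζ.1
  exact ⟨y₀, hy₀, z,
    hz.congr_ae (ae_eq_signControl_of_mem_normalCone hη hT hne hu hy₀ hz hζ), rfl⟩

end MaximumPrinciple

section NormalCone

variable {n m : ℕ}

theorem notMem_interior_of_mem_normalCone {R : Set (Vec n)} {x ζ : Vec n}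
    (hζ : ζ ∈ normalCone R x) (hζ0 : ζ ≠ 0) : x ∉ interior R := by
  intro hx
  have hline : Tendsto (fun s : ℝ => x + s • ζ) (𝓝 0) (𝓝 x) := by
    have hcont : Continuous fun s : ℝ => x + s • ζ := by fun_prop
    simpa using hcont.tendsto 0
  obtain ⟨s, hs, hs_pos⟩ := (((hline.mono_left nhdsWithin_le_nhds).eventually
    (mem_interior_iff_mem_nhds.1 hx)).and self_mem_nhdsWithin : ∀ᶠ s in 𝓝[>] (0 : ℝ), _).exists
  have hle := hζ.2 _ hs
  rw [add_sub_cancel_left, inner_smul_right, real_inner_self_eq_norm_sq] at hle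
  exact hle.not_gt (mul_pos hs_pos (by positivity))

theorem StrictlyExpanding.mono {A : Matrix (Fin n) (Fin n) ℝ} {B : Matrix (Fin n) (Fin m) ℝ}
    {U : Set (Vec m)} {S : Set (Vec n)} {T T' : ℝ} (hexp : StrictlyExpanding A B U S T')
    (hT : T ≤ T') : StrictlyExpanding A B U S T :=
  fun s t hs hst ht => hexp s t hs hst (ht.trans hT)

theorem minTime_eq_of_mem_normalCone {A : Matrix (Fin n) (Fin n) ℝ} {B : Matrix (Fin n) (Fin m) ℝ}
    {U : Set (Vec m)} {S : Set (Vec n)} {T : ℝ} (hT : 0 ≤ T) (hexp : StrictlyExpanding A B U S T)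
    {yhat ζ : Vec n} (hζ : ζ ∈ normalCone (reach A B U S T) yhat) (hζ0 : ζ ≠ 0) :
    minTime A B U S yhat = ENNReal.ofReal T := by
  refine le_antisymm (sInf_le ⟨T, hT, hζ.1, rfl⟩) (le_sInf ?_)
  rintro _ ⟨t, ht, hmem, rfl⟩
  refine ENNReal.ofReal_le_ofReal (not_lt.1 fun hlt => ?_)
  exact notMem_interior_of_mem_normalCone hζ hζ0 (hexp t T ht hlt le_rfl hmem)

theorem exists_sub_mem_normalCone {C : Set (Vec n)} (hne : C.Nonempty) (hclosed : IsClosed C)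
    (hconvex : Convex ℝ C) (x : Vec n) : ∃ y, x - y ∈ normalCone C y := by
  obtain ⟨y, hy, hmin⟩ := exists_norm_eq_iInf_of_complete_convex hne hclosed.isComplete hconvex x
  exact ⟨y, hy, (norm_eq_iInf_iff_real_inner_le_zero hconvex hy).1 hmin⟩

theorem norm_sub_sq_le_of_mem_normalCone {R C : Set (Vec n)} {x y ζ : Vec n} {ε : ℝ}
    (hζ : ζ ∈ normalCone R x) (hy : x + ζ - y ∈ normalCone C y)
    (hdist : Metric.hausdorffEDist C R < ENNReal.ofReal ε) :
    ‖y - x‖ ^ 2 ≤ ε * (2 * ‖ζ‖ + ‖y - x‖) := by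
  obtain ⟨c, hc, hyc⟩ := Metric.exists_edist_lt_of_hausdorffEDist_lt hy.1 hdist
  obtain ⟨x', hx', hxx'⟩ := Metric.exists_edist_lt_of_hausdorffEDist_lt hζ.1
    (by rwa [Metric.hausdorffEDist_comm] at hdist)
  rw [edist_lt_ofReal, dist_eq_norm] at hyc hxx'
  have hζy : inner ℝ ζ (y - x) ≤ ‖ζ‖ * ε := by
    have hsplit : inner ℝ ζ (y - x) = inner ℝ ζ (c - x) + inner ℝ ζ (y - c) := by
      rw [← inner_add_right]; congr 1; abel
    have hbound : inner ℝ ζ (y - c) ≤ ‖ζ‖ * ε :=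
      (real_inner_le_norm _ _).trans (by gcongr)
    linarith [hζ.2 c hc]
  have hproj : inner ℝ (x + ζ - y) (x - y) ≤ (‖ζ‖ + ‖y - x‖) * ε := by
    have hsplit : inner ℝ (x + ζ - y) (x - y) =
        inner ℝ (x + ζ - y) (x' - y) + inner ℝ (x + ζ - y) (x - x') := by
      rw [← inner_add_right]; congr 1; abel
    have hnorm : ‖x + ζ - y‖ ≤ ‖ζ‖ + ‖y - x‖ := by
      rw [show x + ζ - y = ζ - (y - x) by abel]; exact norm_sub_le _ _
    have hbound : inner ℝ (x + ζ - y) (x - x') ≤ (‖ζ‖ + ‖y - x‖) * ε :=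
      (real_inner_le_norm _ _).trans (by gcongr)
    linarith [hy.2 x' hx']
  have hexpand : inner ℝ (x + ζ - y) (x - y) = ‖y - x‖ ^ 2 - inner ℝ ζ (y - x) := by
    rw [show x + ζ - y = ζ - (y - x) by abel, show x - y = -(y - x) by abel, inner_neg_right,
      inner_sub_left, real_inner_self_eq_norm_sq]
    ring
  linarith

theorem exists_tendsto_normalCone {ι : Type*} {l : Filter ι} {R : Set (Vec n)}
    {C : ι → Set (Vec n)} (hclosed : ∀ ν, IsClosed (C ν)) (hconvex : ∀ ν, Convex ℝ (C ν))
    (hconv : Tendsto (fun ν => Metric.hausdorffEDist (C ν) R) l (𝓝 0))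
    {x ζ : Vec n} (hζ : ζ ∈ normalCone R x) :
    ∃ y ξ : ι → Vec n, (∀ᶠ ν in l, ξ ν ∈ normalCone (C ν) (y ν)) ∧
      Tendsto (fun ν => (y ν, ξ ν)) l (𝓝 (x, ζ)) := by
  have hproj (ν : ι) : ∃ y, (C ν).Nonempty → x + ζ - y ∈ normalCone (C ν) y := by
    by_cases hne : (C ν).Nonempty
    · exact (exists_sub_mem_normalCone hne (hclosed ν) (hconvex ν) (x + ζ)).imp fun _ h _ => h
    · exact ⟨0, fun h => absurd h hne⟩
  choose y hy using hproj
  have hnonempty : ∀ᶠ ν in l, (C ν).Nonempty := by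
    filter_upwards [hconv.eventually_lt_const ENNReal.zero_lt_top] with ν hν
    exact Metric.nonempty_of_hausdorffEDist_ne_top ⟨x, hζ.1⟩
      (by rw [Metric.hausdorffEDist_comm]; exact hν.ne)
  have hmem : ∀ᶠ ν in l, x + ζ - y ν ∈ normalCone (C ν) (y ν) := hnonempty.mono hy
  have hlim : Tendsto y l (𝓝 x) := by
    refine Metric.tendsto_nhds.2 fun δ hδ => ?_
    -- For `r ≥ δ` this choice of `ε` gives `ε (2‖ζ‖ + r) ≤ δ r / 2 < r²`.
    set ε := δ ^ 2 / (2 * (2 * ‖ζ‖ + δ)) with hε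
    have hε_pos : 0 < ε := by positivity
    have hε_mul : ε * (2 * ‖ζ‖ + δ) = δ ^ 2 / 2 := by rw [hε]; field_simp
    filter_upwards [hmem, hconv.eventually_lt_const (ENNReal.ofReal_pos.2 hε_pos)] with ν hν hdist
    have hle := norm_sub_sq_le_of_mem_normalCone hζ hν hdist
    rw [dist_eq_norm]
    by_contra! hge
    have hε_le : δ * (ε * (2 * ‖ζ‖ + ‖y ν - x‖)) ≤ δ * (δ / 2 * ‖y ν - x‖) :=
      calc δ * (ε * (2 * ‖ζ‖ + ‖y ν - x‖)) = ε * (2 * ‖ζ‖ * δ + δ * ‖y ν - x‖) := by ring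
        _ ≤ ε * (2 * ‖ζ‖ * ‖y ν - x‖ + δ * ‖y ν - x‖) := by gcongr
        _ = δ * (δ / 2 * ‖y ν - x‖) := by linear_combination ‖y ν - x‖ * hε_mul
    nlinarith [hle.trans (le_of_mul_le_mul_left hε_le hδ), hδ.trans_le hge]
  refine ⟨y, fun ν => x + ζ - y ν, hmem, hlim.prodMk_nhds ?_⟩
  simpa using hlim.const_sub (x + ζ)

end NormalCone

theorem transition_self {n : ℕ} (step : ℕ → Matrix (Fin n) (Fin n) ℝ) (a : ℕ) :
    transition step a a = 1 := by
  cases a <;> simp [transition]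

namespace Discretization

section Grid

variable {n m : ℕ} {Δt : ℝ} {i : ℕ} {t : ℝ}

theorem h_pos (D : Discretization n m) (hΔt : 0 < Δt) : 0 < D.h Δt :=
  div_pos hΔt (by exact_mod_cast D.N_pos)

theorem N_mul_h (D : Discretization n m) (Δt : ℝ) : D.N * D.h Δt = Δt :=
  mul_div_cancel₀ Δt (by exact_mod_cast D.N_pos.ne')

theorem grid_eq (D : Discretization n m) (Δt : ℝ) (k j : ℕ) :
    D.grid Δt k j = ((k * D.N + j : ℕ) : ℝ) * D.h Δt := by
  rw [grid]
  push_cast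
  linear_combination -(k : ℝ) * D.N_mul_h Δt

theorem grid_succ_zero (D : Discretization n m) (Δt : ℝ) (k : ℕ) :
    D.grid Δt (k + 1) 0 = (k + 1 : ℕ) * Δt := by
  simp [grid]

theorem grid_succ_zero_sub_mem_Icc (D : Discretization n m) (hΔt : 0 < Δt) (k : ℕ) {j : ℕ}
    (hj : j ≤ D.N) : D.grid Δt (k + 1) 0 - D.grid Δt k j ∈ Icc 0 Δt := by
  have hsub : D.grid Δt (k + 1) 0 - D.grid Δt k j = Δt - j * D.h Δt := by
    rw [grid_succ_zero, grid]
    push_cast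
    ring
  have hle : j * D.h Δt ≤ D.N * D.h Δt := by
    have hh := D.h_pos hΔt
    gcongr
  rw [D.N_mul_h] at hle
  rw [hsub]
  exact ⟨sub_nonneg.2 hle, sub_le_self _ (mul_nonneg j.cast_nonneg (D.h_pos hΔt).le)⟩

/-- The global index `kN + j` of the last grid point `t_{kj}` that is not to the right of `t`. -/
noncomputable def index (D : Discretization n m) (Δt t : ℝ) : ℕ := ⌊t / D.h Δt⌋₊

theorem measurable_index (D : Discretization n m) (Δt : ℝ) : Measurable (D.index Δt) :=
  Nat.measurable_floor.comp (measurable_id.div_const _)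

theorem index_div_lt (D : Discretization n m) (hΔt : 0 < Δt) (ht : t ∈ Ico 0 (i * Δt)) :
    D.index Δt t / D.N < i := by
  have hh := D.h_pos hΔt
  rw [Nat.div_lt_iff_lt_mul D.N_pos, index, Nat.floor_lt (div_nonneg ht.1 hh.le),
    div_lt_iff₀ hh]
  push_cast
  rw [mul_assoc, D.N_mul_h]
  exact ht.2

theorem index_mod_lt (D : Discretization n m) (Δt t : ℝ) : D.index Δt t % D.N < D.N :=
  Nat.mod_lt _ D.N_pos

theorem mem_Ico_grid_index (D : Discretization n m) (hΔt : 0 < Δt) (ht : 0 ≤ t) :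
    t ∈ Ico (D.grid Δt (D.index Δt t / D.N) (D.index Δt t % D.N))
      (D.grid Δt (D.index Δt t / D.N) (D.index Δt t % D.N + 1)) := by
  have hh := D.h_pos hΔt
  rw [grid_eq, grid_eq, ← add_assoc, Nat.div_add_mod']
  refine ⟨(le_div_iff₀ hh).1 (Nat.floor_le (div_nonneg ht hh.le)), ?_⟩
  rw [← div_lt_iff₀ hh]
  exact_mod_cast Nat.lt_floor_add_one (t / D.h Δt)

variable {ι : Type*} {l : Filter ι} {D : ι → Discretization n m}

theorem tendsto_h (hN : Tendsto (fun ν => (D ν).N) l atTop) (Δt : ℝ) :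
    Tendsto (fun ν => (D ν).h Δt) l (𝓝 0) :=
  (tendsto_const_div_atTop_nhds_zero_nat Δt).comp hN

theorem tendsto_const_mul_h_rpow (hN : Tendsto (fun ν => (D ν).N) l atTop) (Δt C : ℝ) {p : ℝ}
    (hp : 0 < p) : Tendsto (fun ν => C * (D ν).h Δt ^ p) l (𝓝 0) := by
  simpa [hp.ne'] using ((tendsto_h hN Δt).rpow_const (Or.inr hp.le)).const_mul C

theorem tendsto_grid_index (hN : Tendsto (fun ν => (D ν).N) l atTop) (hΔt : 0 < Δt)
    (ht : 0 ≤ t) :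
    Tendsto (fun ν => (D ν).grid Δt ((D ν).index Δt t / (D ν).N) ((D ν).index Δt t % (D ν).N))
      l (𝓝 t) := by
  have hlower : Tendsto (fun ν => t - (D ν).h Δt) l (𝓝 t) := by
    simpa using (tendsto_h hN Δt).const_sub t
  refine tendsto_of_tendsto_of_tendsto_of_le_of_le hlower tendsto_const_nhds (fun ν => ?_)
    fun ν => ((D ν).mem_Ico_grid_index hΔt ht).1
  have hlt := ((D ν).mem_Ico_grid_index hΔt ht).2
  simp only [grid_eq] at hlt ⊢
  push_cast at hlt ⊢
  linarith

end Grid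

section ReachSet

variable {n m : ℕ} {D : Discretization n m}

theorem IsRun.isCompact_reachSet {Bbar : Matrix (Fin n) (Fin m) ℝ} {U : Set (Vec m)}
    {S : Set (Vec n)} {Δt : ℝ} {K k : ℕ} (hrun : D.IsRun Bbar U S Δt K) (hk : 1 ≤ k)
    (hkK : k ≤ K) : IsCompact (D.reachSet k) := by
  obtain ⟨k, rfl⟩ := Nat.exists_eq_add_of_le' hk
  obtain ⟨f, -, hY⟩ := hrun.next k hkK
  rw [reachSet, hY]
  exact (D.dirR.finite_toSet.image f).isCompact_convexHull (𝕜 := ℝ)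

end ReachSet

section Adjoint

theorem SolverError.mono {n m : ℕ} {D : Discretization n m} {Abar : Matrix (Fin n) (Fin n) ℝ}
    {Δt ε : ℝ} {i K : ℕ} (hsolver : D.SolverError Abar Δt K ε) (hiK : i ≤ K) :
    D.SolverError Abar Δt i ε :=
  fun k hk => hsolver k (hk.trans_le hiK)

variable {n m : ℕ} {Abar : Matrix (Fin n) (Fin n) ℝ} {Δt T : ℝ} {i : ℕ} {ζ : Vec n}
  {η : ℝ → Vec n}

theorem IsAdjoint.eq_rowMul {D : Discretization n m} {η : ℕ → ℕ → Vec n}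
    (hη : D.IsAdjoint i ζ η) {k : ℕ} (hk : k < i) {j : ℕ} (hj : j ≤ D.N) :
    η k j = rowMul (η k D.N) (transition D.step ((k + 1) * D.N) (k * D.N + j)) := by
  rw [Nat.succ_mul]
  induction hj using Nat.decreasingInduction with
  | self => rw [transition_self, rowMul_one]
  | of_succ j hj ih =>
    rw [hη.back k hk j hj, ih, ← rowMul_mul, transition_mul _ (by lia) (by lia)]

theorem IsAdjoint.norm_sub_le {D : Discretization n m} {ε M : ℝ}
    (hsolver : D.SolverError Abar Δt i ε)
    (hM : ∀ s ∈ Icc 0 Δt, specNorm (NormedSpace.exp (s • Abar)) ≤ M) (hΔt : 0 < Δt)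
    (hη : MinTime.IsAdjoint Abar T ζ η) {ζh : Vec n} {ηh : ℕ → ℕ → Vec n}
    (hηh : D.IsAdjoint i ζh ηh) {k : ℕ} (hk : k < i) {j : ℕ} (hj : j ≤ D.N) :
    ‖ηh k j - η (D.grid Δt k j)‖ ≤
      M * ‖ηh k D.N - η ((k + 1 : ℕ) * Δt)‖ + ε * ‖ηh k D.N‖ := by
  set E := NormedSpace.exp ((D.grid Δt (k + 1) 0 - D.grid Δt k j) • Abar) with hE
  set Φ := transition D.step ((k + 1) * D.N) (k * D.N + j)
  have hexact : η (D.grid Δt k j) = rowMul (η ((k + 1 : ℕ) * Δt)) E := by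
    rw [hE, ← D.grid_succ_zero, hη.rowMul_exp]
  have hsplit : ηh k j - η (D.grid Δt k j) =
      rowMul (ηh k D.N - η ((k + 1 : ℕ) * Δt)) E - rowMul (ηh k D.N) (E - Φ) := by
    rw [hηh.eq_rowMul hk hj, hexact, rowMul_sub, sub_rowMul]
    abel
  rw [hsplit]
  refine (_root_.norm_sub_le _ _).trans (add_le_add ?_ ?_)
  · refine (norm_rowMul_le _ _).trans ?_
    gcongr
    exact hM _ (D.grid_succ_zero_sub_mem_Icc hΔt k hj)
  · refine (norm_rowMul_le _ _).trans ?_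
    gcongr
    exact hsolver k hk j hj

variable {ι : Type*} {l : Filter ι} {D : ι → Discretization n m} {ε : ι → ℝ} {ζh : ι → Vec n}
  {ηh : ι → ℕ → ℕ → Vec n}

theorem IsAdjoint.eventually_norm_sub_lt_of_tendsto_right (hε : Tendsto ε l (𝓝 0))
    (hsolver : ∀ ν, (D ν).SolverError Abar Δt i (ε ν)) (hΔt : 0 < Δt)
    (hη : MinTime.IsAdjoint Abar T ζ η) (hηh : ∀ ν, (D ν).IsAdjoint i (ζh ν) (ηh ν)) {k : ℕ}
    (hk : k < i)
    (hright : Tendsto (fun ν => ηh ν k (D ν).N) l (𝓝 (η ((k + 1 : ℕ) * Δt)))) {δ : ℝ}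
    (hδ : 0 < δ) :
    ∀ᶠ ν in l, ∀ j ≤ (D ν).N, ‖ηh ν k j - η ((D ν).grid Δt k j)‖ < δ := by
  obtain ⟨M, -, hM⟩ := exists_specNorm_exp_smul_le Abar 0 Δt
  have hbound : Tendsto (fun ν => M * ‖ηh ν k (D ν).N - η ((k + 1 : ℕ) * Δt)‖ +
      ε ν * ‖ηh ν k (D ν).N‖) l (𝓝 0) := by
    simpa using ((tendsto_iff_norm_sub_tendsto_zero.1 hright).const_mul M).add
      (hε.mul hright.norm)
  filter_upwards [hbound.eventually_lt_const hδ] with ν hν j hj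
  exact (IsAdjoint.norm_sub_le (hsolver ν) hM hΔt hη (hηh ν) hk hj).trans_lt hν

theorem IsAdjoint.tendsto_right (hε : Tendsto ε l (𝓝 0))
    (hsolver : ∀ ν, (D ν).SolverError Abar Δt i (ε ν)) (hΔt : 0 < Δt)
    (hη : MinTime.IsAdjoint Abar (i * Δt) ζ η) (hηh : ∀ ν, (D ν).IsAdjoint i (ζh ν) (ηh ν))
    (hζh : Tendsto ζh l (𝓝 ζ)) {k : ℕ} (hk : k < i) :
    Tendsto (fun ν => ηh ν k (D ν).N) l (𝓝 (η ((k + 1 : ℕ) * Δt))) := by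
  obtain ⟨i, rfl⟩ := Nat.exists_eq_add_one_of_ne_zero (Nat.ne_zero_of_lt hk)
  induction Nat.le_of_lt_succ hk using Nat.decreasingInduction with
  | self =>
    have hfinal (ν : ι) : ηh ν i (D ν).N = ζh ν := (hηh ν).final
    simpa only [hη.2, hfinal] using hζh
  | of_succ k hki ih =>
    have hki' : k + 1 < i + 1 := Nat.succ_lt_succ hki
    refine Metric.tendsto_nhds.2 fun δ hδ => ?_
    filter_upwards [eventually_norm_sub_lt_of_tendsto_right hε hsolver hΔt hη hηh hki'
      (ih hki') hδ] with ν hν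
    rw [(hηh ν).glue k hki', ← (D ν).grid_succ_zero, dist_eq_norm]
    exact hν 0 (Nat.zero_le _)

theorem IsAdjoint.eventually_norm_sub_lt (hε : Tendsto ε l (𝓝 0))
    (hsolver : ∀ ν, (D ν).SolverError Abar Δt i (ε ν)) (hΔt : 0 < Δt)
    (hη : MinTime.IsAdjoint Abar (i * Δt) ζ η) (hηh : ∀ ν, (D ν).IsAdjoint i (ζh ν) (ηh ν))
    (hζh : Tendsto ζh l (𝓝 ζ)) {δ : ℝ} (hδ : 0 < δ) :
    ∀ᶠ ν in l, ∀ k < i, ∀ j ≤ (D ν).N, ‖ηh ν k j - η ((D ν).grid Δt k j)‖ < δ :=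
  (eventually_all_finite (finite_lt_nat i)).2 fun _ hk =>
    eventually_norm_sub_lt_of_tendsto_right hε hsolver hΔt hη hηh hk
      (tendsto_right hε hsolver hΔt hη hηh hζh hk) hδ

theorem IsAdjoint.tendsto_index (hN : Tendsto (fun ν => (D ν).N) l atTop)
    (hε : Tendsto ε l (𝓝 0)) (hsolver : ∀ ν, (D ν).SolverError Abar Δt i (ε ν)) (hΔt : 0 < Δt)
    (hη : MinTime.IsAdjoint Abar (i * Δt) ζ η) (hηh : ∀ ν, (D ν).IsAdjoint i (ζh ν) (ηh ν))
    (hζh : Tendsto ζh l (𝓝 ζ)) {t : ℝ} (ht : t ∈ Ico 0 (i * Δt)) :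
    Tendsto (fun ν => ηh ν ((D ν).index Δt t / (D ν).N) ((D ν).index Δt t % (D ν).N))
      l (𝓝 (η t)) := by
  refine tendsto_of_tendsto_of_dist
    ((hη.continuous.tendsto t).comp (tendsto_grid_index hN hΔt ht.1)) ?_
  refine Metric.tendsto_nhds.2 fun δ hδ => ?_
  filter_upwards [eventually_norm_sub_lt hε hsolver hΔt hη hηh hζh hδ] with ν hν
  rw [Real.dist_0_eq_abs, abs_of_nonneg dist_nonneg, dist_comm, dist_eq_norm]
  exact hν _ ((D ν).index_div_lt hΔt ht) _ ((D ν).index_mod_lt Δt t).le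

end Adjoint

section SignControl

variable {n m : ℕ} {D : Discretization n m} {Bbar : Matrix (Fin n) (Fin m) ℝ} {Δt : ℝ} {i : ℕ}
  {η : ℕ → ℕ → Vec n} {u : ℝ → Vec m}

theorem IsSignControl.apply_eq (hu : D.IsSignControl Bbar Δt i η u) (hΔt : 0 < Δt) {t : ℝ}
    (ht : t ∈ Ico 0 (i * Δt)) :
    u t = signVec (rowMul (η (D.index Δt t / D.N) (D.index Δt t % D.N)) Bbar) :=
  hu.piece _ (D.index_div_lt hΔt ht) _ (D.index_mod_lt Δt t) t (D.mem_Ico_grid_index hΔt ht.1)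

theorem IsSignControl.mem_cube (hu : D.IsSignControl Bbar Δt i η u) (hΔt : 0 < Δt) {t : ℝ}
    (ht : t ∈ Ico 0 (i * Δt)) : u t ∈ cube m := by
  rw [hu.apply_eq hΔt ht]
  exact signVec_mem_cube _

theorem IsSignControl.aestronglyMeasurable (hu : D.IsSignControl Bbar Δt i η u) (hΔt : 0 < Δt) :
    AEStronglyMeasurable u (volume.restrict (Ico 0 (i * Δt))) := by
  have hmeas : Measurable fun t =>
      signVec (rowMul (η (D.index Δt t / D.N) (D.index Δt t % D.N)) Bbar) :=
    (measurable_from_nat (f := fun q => signVec (rowMul (η (q / D.N) (q % D.N)) Bbar))).comp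
      (D.measurable_index Δt)
  exact hmeas.aestronglyMeasurable.congr (.symm <|
    (ae_restrict_mem measurableSet_Ico).mono fun t ht => hu.apply_eq hΔt ht)

end SignControl

end Discretization

section Norm1

variable {m : ℕ}

theorem norm1_nonneg (v : Vec m) : 0 ≤ norm1 v :=
  Finset.sum_nonneg fun _ _ => abs_nonneg _

theorem continuous_norm1 : Continuous (norm1 (m := m)) :=
  continuous_finsetSum _ fun μ _ => (EuclideanSpace.proj (𝕜 := ℝ) μ).continuous.abs

theorem norm1_sub_le_of_mem_cube {v w : Vec m} (hv : v ∈ cube m) (hw : w ∈ cube m) :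
    norm1 (v - w) ≤ 2 * m := by
  have hcoord (μ : Fin m) : |(v - w) μ| ≤ 2 := by
    rw [PiLp.sub_apply, abs_le]
    constructor <;> linarith [(hv μ).1, (hv μ).2, (hw μ).1, (hw μ).2]
  calc norm1 (v - w) ≤ ∑ _μ : Fin m, (2 : ℝ) := Finset.sum_le_sum fun μ _ => hcoord μ
    _ = 2 * m := by simp [mul_comm]

variable {α : Type*} [MeasurableSpace α] {P : Measure α} {v : α → Vec m}

theorem ae_norm_norm1_sub_le {w : α → Vec m} (hv : ∀ᵐ x ∂P, v x ∈ cube m)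
    (hw : ∀ᵐ x ∂P, w x ∈ cube m) : ∀ᵐ x ∂P, ‖norm1 (v x - w x)‖ ≤ 2 * m := by
  filter_upwards [hv, hw] with x hvx hwx
  rw [Real.norm_of_nonneg (norm1_nonneg _)]
  exact norm1_sub_le_of_mem_cube hvx hwx

variable [IsFiniteMeasure P]

theorem integrable_norm1_sub {w : α → Vec m} (hv_meas : AEStronglyMeasurable v P)
    (hw_meas : AEStronglyMeasurable w P) (hv : ∀ᵐ x ∂P, v x ∈ cube m)
    (hw : ∀ᵐ x ∂P, w x ∈ cube m) : Integrable (fun x => norm1 (v x - w x)) P :=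
  .of_bound (continuous_norm1.comp_aestronglyMeasurable (hv_meas.sub hw_meas)) (2 * m)
    (ae_norm_norm1_sub_le hv hw)

theorem tendsto_integral_norm1_sub {ι : Type*} {l : Filter ι} [l.IsCountablyGenerated]
    {w : ι → α → Vec m} (hv_meas : AEStronglyMeasurable v P)
    (hw_meas : ∀ ν, AEStronglyMeasurable (w ν) P) (hv : ∀ᵐ x ∂P, v x ∈ cube m)
    (hw : ∀ ν, ∀ᵐ x ∂P, w ν x ∈ cube m) (hlim : ∀ᵐ x ∂P, ∀ᶠ ν in l, w ν x = v x) :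
    Tendsto (fun ν => ∫ x, norm1 (v x - w ν x) ∂P) l (𝓝 0) := by
  have hdom := tendsto_integral_filter_of_dominated_convergence (l := l) (f := fun _ => 0)
    (F := fun ν x => norm1 (v x - w ν x)) (fun _ => 2 * m)
    (.of_forall fun ν => (integrable_norm1_sub hv_meas (hw_meas ν) hv (hw ν)).1)
    (.of_forall fun ν => ae_norm_norm1_sub_le hv (hw ν)) (integrable_const _) (by
      filter_upwards [hlim] with x hx
      refine tendsto_const_nhds.congr' (hx.mono fun ν hν => ?_)
      simp [hν, norm1])
  simpa using hdom

end Norm1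

namespace Discretization

section ControlConvergence

variable {n m : ℕ} {ι : Type*} {l : Filter ι} {D : ι → Discretization n m} {u : ι → ℝ → Vec m}
  {Abar : Matrix (Fin n) (Fin n) ℝ} {Bbar : Matrix (Fin n) (Fin m) ℝ} {Δt : ℝ} {i : ℕ}
  {ε : ι → ℝ} {ζ : Vec n} {η : ℝ → Vec n} {ζh : ι → Vec n} {ηh : ι → ℕ → ℕ → Vec n}

theorem IsSignControl.eventually_eq (hN : Tendsto (fun ν => (D ν).N) l atTop)
    (hε : Tendsto ε l (𝓝 0)) (hsolver : ∀ ν, (D ν).SolverError Abar Δt i (ε ν)) (hΔt : 0 < Δt)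
    (hη : MinTime.IsAdjoint Abar (i * Δt) ζ η) (hηh : ∀ ν, (D ν).IsAdjoint i (ζh ν) (ηh ν))
    (hζh : Tendsto ζh l (𝓝 ζ)) (hu : ∀ ν, (D ν).IsSignControl Bbar Δt i (ηh ν) (u ν)) {t : ℝ}
    (ht : t ∈ Ico 0 (i * Δt)) (hne : ∀ μ, rowMul (η t) Bbar μ ≠ 0) :
    ∀ᶠ ν in l, u ν t = signControl Bbar η t := by
  have hlim := ((continuous_rowMul Bbar).tendsto (η t)).comp
    (IsAdjoint.tendsto_index hN hε hsolver hΔt hη hηh hζh ht)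
  filter_upwards [hlim.eventually (eventually_signVec_eq hne)] with ν hν
  rw [(hu ν).apply_eq hΔt ht]
  exact hν

theorem IsSignControl.intervalIntegrable_norm1_sub {D : Discretization n m}
    {η : ℕ → ℕ → Vec n} {u v : ℝ → Vec m} (hu : D.IsSignControl Bbar Δt i η u) (hΔt : 0 < Δt)
    (hv : IsAdmissible (cube m) v) :
    IntervalIntegrable (fun t => norm1 (v t - u t)) volume 0 (i * Δt) := by
  rw [intervalIntegrable_iff_integrableOn_Ico_of_le (by positivity)]
  exact integrable_norm1_sub hv.1.aestronglyMeasurable (hu.aestronglyMeasurable hΔt)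
    (ae_of_all _ hv.2) ((ae_restrict_mem measurableSet_Ico).mono fun t => hu.mem_cube hΔt)

theorem IsSignControl.tendsto_integral_norm1_sub [l.IsCountablyGenerated]
    (hN : Tendsto (fun ν => (D ν).N) l atTop) (hε : Tendsto ε l (𝓝 0))
    (hsolver : ∀ ν, (D ν).SolverError Abar Δt i (ε ν)) (hΔt : 0 < Δt)
    (hη : MinTime.IsAdjoint Abar (i * Δt) ζ η) (hηh : ∀ ν, (D ν).IsAdjoint i (ζh ν) (ηh ν))
    (hζh : Tendsto ζh l (𝓝 ζ)) (hu : ∀ ν, (D ν).IsSignControl Bbar Δt i (ηh ν) (u ν))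
    (hne : ∀ᵐ t, ∀ μ, rowMul (η t) Bbar μ ≠ 0) :
    Tendsto (fun ν => ∫ t in (0 : ℝ)..(i * Δt), norm1 (signControl Bbar η t - u ν t)) l (𝓝 0) := by
  have hv : IsAdmissible (cube m) (signControl Bbar η) :=
    isAdmissible_signControl Bbar hη.continuous
  have hT : 0 ≤ i * Δt := by positivity
  simp only [intervalIntegral.integral_of_le hT, ← integral_Ico_eq_integral_Ioc]
  refine MinTime.tendsto_integral_norm1_sub hv.1.aestronglyMeasurable
    (fun ν => (hu ν).aestronglyMeasurable hΔt) (ae_of_all _ hv.2)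
    (fun ν => (ae_restrict_mem measurableSet_Ico).mono fun t => (hu ν).mem_cube hΔt) ?_
  filter_upwards [ae_restrict_mem measurableSet_Ico, ae_restrict_of_ae hne] with t ht hne_t
  exact eventually_eq hN hε hsolver hΔt hη hηh hζh hu ht hne_t

end ControlConvergence

end Discretization

end MinTime

theorem mainTheorem4_general {n m : ℕ}
    (A : Matrix (Fin n) (Fin n) ℝ) (B : Matrix (Fin n) (Fin m) ℝ) (S : Set (Vec n))
    (Δt : ℝ) (hΔt : 0 < Δt) (i : ℕ)
    (hexp : StrictlyExpanding A B (cube m) S (i * Δt))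
    (hnormal : IsNormal A B (cube m))
    {ι : Type*} {l : Filter ι} [l.IsCountablyGenerated] (D : ι → Discretization n m)
    (hN : Tendsto (fun ν => (D ν).N) l atTop)
    (hclosed : ∀ ν, IsClosed ((D ν).reachSet i))
    (ε : ι → ℝ) (hε : Tendsto ε l (𝓝 0)) (hsolver : ∀ ν, (D ν).SolverError (-A) Δt i (ε ν))
    (hconv : Tendsto (fun ν => Metric.hausdorffEDist ((D ν).reachSet i)
      (reach A B (cube m) S (i * Δt))) l (𝓝 0))
    (yhat ζ : Vec n) (hζ : ζ ∈ normalCone (reach A B (cube m) S (i * Δt)) yhat)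
    (hζ0 : ζ ≠ 0)
    (η : ℝ → Vec n) (hη : IsAdjoint (-A) (i * Δt) ζ η) :
    (IsAdmissible (cube m) (signControl (-B) η) ∧
      (∃ y₀ ∈ S, ∃ y, IsTrajectory (-A) (-B) (signControl (-B) η) y₀ (i * Δt) y ∧
        y (i * Δt) = yhat) ∧
      minTime A B (cube m) S yhat = ENNReal.ofReal (i * Δt)) ∧
    (∃ yh ζh : ι → Vec n,
      (∀ᶠ ν in l, ζh ν ∈ normalCone ((D ν).reachSet i) (yh ν)) ∧
      Tendsto (fun ν => (yh ν, ζh ν)) l (𝓝 (yhat, ζ))) ∧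
    ∀ ζh : ι → Vec n, Tendsto ζh l (𝓝 ζ) →
      ∀ ηh : ι → ℕ → ℕ → Vec n, (∀ ν, (D ν).IsAdjoint i (ζh ν) (ηh ν)) →
      ∀ uh : ι → ℝ → Vec m, (∀ ν, (D ν).IsSignControl (-B) Δt i (ηh ν) (uh ν)) →
        (∀ ν, IntervalIntegrable (fun t => norm1 (signControl (-B) η t - uh ν t))
          MeasureTheory.volume 0 (i * Δt)) ∧
        Tendsto (fun ν => ∫ t in (0 : ℝ)..(i * Δt), norm1 (signControl (-B) η t - uh ν t))
          l (𝓝 0) := by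
  have hT : 0 ≤ i * Δt := by positivity
  have hne := hnormal.ae_switching_ne_zero hη hζ0
  have hadm : IsAdmissible (cube m) (signControl (-B) η) :=
    isAdmissible_signControl (-B) hη.continuous
  refine ⟨⟨hadm, exists_isTrajectory_signControl hη hT hne hζ,
      minTime_eq_of_mem_normalCone hT hexp hζ hζ0⟩,
    exists_tendsto_normalCone hclosed (fun ν => convex_convexHull ℝ _) hconv hζ,
    fun ζh hζh ηh hηh uh huh => ⟨fun ν => (huh ν).intervalIntegrable_norm1_sub hΔt hadm, ?_⟩⟩
  exact Discretization.IsSignControl.tendsto_integral_norm1_sub hN hε hsolver hΔt hη hηh hζh huh hne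

theorem mainTheorem4 {n m : ℕ}
    (A : Matrix (Fin n) (Fin n) ℝ) (B : Matrix (Fin n) (Fin m) ℝ)
    (tf : ℝ) (htf : 0 < tf) (K : ℕ) (hK : 0 < K) (Δt : ℝ) (hΔt : Δt = tf / K)
    (hexp : StrictlyExpanding A B (cube m) {0} tf)
    (hnormal : IsNormal A B (cube m))
    (i : ℕ) (hi : 1 ≤ i) (hiK : i ≤ K)
    (D : ℕ → Discretization n m)
    (hN : Tendsto (fun ν => (D ν).N) atTop atTop)
    (hrun : ∀ ν, (D ν).IsRun (-B) (cube m) {0} Δt K)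
    (p C : ℝ) (hp : 0 < p)
    (hsolver : ∀ ν, (D ν).SolverError (-A) Δt K (C * (D ν).h Δt ^ p))
    (hconv : Tendsto (fun ν => Metric.hausdorffEDist ((D ν).reachSet i)
      (reach A B (cube m) {0} (i * Δt))) atTop (𝓝 0))
    (yhat ζ : Vec n) (hζ : ζ ∈ normalCone (reach A B (cube m) {0} (i * Δt)) yhat)
    (hζ0 : ζ ≠ 0)
    (η : ℝ → Vec n) (hη : IsAdjoint (-A) (i * Δt) ζ η) :
    (IsAdmissible (cube m) (signControl (-B) η) ∧
      (∃ y, IsTrajectory (-A) (-B) (signControl (-B) η) 0 (i * Δt) y ∧ y (i * Δt) = yhat) ∧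
      minTime A B (cube m) {0} yhat = ENNReal.ofReal (i * Δt)) ∧
    (∃ yh ζh : ℕ → Vec n,
      (∀ᶠ ν in atTop, ζh ν ∈ normalCone ((D ν).reachSet i) (yh ν)) ∧
      Tendsto (fun ν => (yh ν, ζh ν)) atTop (𝓝 (yhat, ζ))) ∧
    ∀ yh ζh : ℕ → Vec n,
      (∀ᶠ ν in atTop, ζh ν ∈ normalCone ((D ν).reachSet i) (yh ν)) →
      Tendsto (fun ν => (yh ν, ζh ν)) atTop (𝓝 (yhat, ζ)) →
      ∀ ηh : ℕ → ℕ → ℕ → Vec n, (∀ ν, (D ν).IsAdjoint i (ζh ν) (ηh ν)) →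
      ∀ uh : ℕ → ℝ → Vec m, (∀ ν, (D ν).IsSignControl (-B) Δt i (ηh ν) (uh ν)) →
        (∀ ν, IntervalIntegrable (fun t => norm1 (signControl (-B) η t - uh ν t))
          MeasureTheory.volume 0 (i * Δt)) ∧
        Tendsto (fun ν => ∫ t in (0 : ℝ)..(i * Δt), norm1 (signControl (-B) η t - uh ν t))
          atTop (𝓝 0) := by
  have hKΔt : K * Δt = tf := by rw [hΔt]; field_simp
  have hΔt_pos : 0 < Δt := by rw [hΔt]; positivity
  have hT : i * Δt ≤ tf := by rw [← hKΔt]; gcongr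
  obtain ⟨⟨hadm, ⟨_, rfl, htraj⟩, hmin⟩, hpairs, hlim⟩ :=
    mainTheorem4_general A B {0} Δt hΔt_pos i (hexp.mono hT) hnormal D hN
      (fun ν => ((hrun ν).isCompact_reachSet hi hiK).isClosed) _
      (Discretization.tendsto_const_mul_h_rpow hN Δt C hp) (fun ν => (hsolver ν).mono hiK)
      hconv yhat ζ hζ hζ0 η hη
  exact ⟨⟨hadm, htraj, hmin⟩, hpairs, fun _ ζh _ hpair => hlim ζh hpair.snd_nhds⟩
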